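/- Let $\beta\in\mathbb C$ be different from every nonzero integer (for instance $-\tfrac12<\Re\beta<\tfrac12$; for $\beta=0$ read $1/\Gamma(0)=0$). **The confluent hypergeometric function.** For $a\in\mathbb C$ let $\psi(a,z)=\psi(a,1;z)$ be the Tricomi function: the analytic function on the universal covering of $\mathbb C\setminus\{0\}$ which solves $zu''+(1-z)u'-au=0$ and satisfies $z^{a}\psi(a,z)\to1$ as $z\to\infty$ in $-\tfrac{3\pi}2<\arg z<\tfrac{3\pi}2$, uniformly in every smaller closed sector. For $0<\arg\zeta<2\pi$ put $$M(\zeta)=\begin{pmatrix}\psi(\beta,\zeta)e^{2\pi i\beta}e^{-\zeta/2} & -\psi(1-\beta,e^{-i\pi}\zeta)e^{\pi i\beta}e^{\zeta/2}\frac{\Gamma(1-\beta)}{\Gamma(\beta)}\\ -\psi(1+\beta,\zeta)e^{\pi i\beta}e^{-\zeta/2}\frac{\Gamma(1+\beta)}{\Gamma(-\beta)} & \psi(-\beta,e^{-i\pi}\zeta)e^{\zeta/2}\end{pmatrix},$$ and let $\Psi(\zeta)=M(\zeta)$ for $\Im\zeta>0$ (with $0<\arg\zeta<\pi$) and $\Psi(\zeta)=M(\zeta)\begin{pmatrix}1&0\\2i\sin\pi\beta&1\end{pmatrix}$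 for $\Im\zeta<0$ (with $\pi<\arg\zeta<2\pi$). **The contour.** Let $\Gamma_1,\dots,\Gamma_6$ be the rays from the origin in the directions $\arg\zeta=\tfrac\pi2,\theta_2,\theta_3,\tfrac{3\pi}2,\theta_5,\theta_6$, where $\tfrac\pi2<\theta_2<\pi<\theta_3<\tfrac{3\pi}2<\theta_5<2\pi$ and $0<\theta_6<\tfrac\pi2$. The rays $\Gamma_1,\Gamma_2,\Gamma_6$ are oriented away from the origin, $\Gamma_3,\Gamma_4,\Gamma_5$ towards it; the $+$ side is on the left of the orientation, the $-$ side on the right. Let $I,II,III,IV,V,VI$ be the open sectors between $\Gamma_1$ and $\Gamma_2$, $\Gamma_2$ and $\Gamma_3$, $\Gamma_3$ and $\Gamma_4$, $\Gamma_4$ and $\Gamma_5$, $\Gamma_5$ and $\Gamma_6$, $\Gamma_6$ and $\Gamma_1$, respectively (so $II$ contains the negative and $V$ the positive real half-axis). **The Riemann–Hilbert problem.** (a) $\Psi_\beta$ is an analytic $2\times2$-matrix-valued function on $\mathbb C\setminus\bigcup_{j=1}^6\Gamma_j$. (b) At every point of $\Gamma_j\setminus\{0\}$ the boundary values $\Psi_{\beta,\pm}$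 from the two sides exist, and $\Psi_{\beta,+}=\Psi_{\beta,-}J_j$ with $$J_1=\begin{pmatrix}0&e^{-i\pi\beta}\\-e^{i\pi\beta}&0\end{pmatrix},\quad J_4=\begin{pmatrix}0&e^{i\pi\beta}\\-e^{-i\pi\beta}&0\end{pmatrix},\quad J_2=J_6=\begin{pmatrix}1&0\\e^{i\pi\beta}&1\end{pmatrix},\quad J_3=J_5=\begin{pmatrix}1&0\\e^{-i\pi\beta}&1\end{pmatrix}.$$ **Proposition.** For each $a\in\{\beta,-\beta,1-\beta,1+\beta\}$ the function $\psi(a,\cdot)$ exists and is unique, and the following formulas give a solution of the Riemann–Hilbert problem (a), (b): $$\Psi_\beta(\zeta)=\Psi(\zeta)\ \text{ for }\zeta\in I\cup III,\qquad \Psi_\beta(\zeta)=\Psi(\zeta)\begin{pmatrix}1&0\\e^{i\pi\beta\varepsilon}&1\end{pmatrix}\ \text{ for }\zeta\in II,$$ $$\Psi_\beta(\zeta)=\Psi(\zeta)\begin{pmatrix}0&-e^{i\pi\beta}\\e^{-i\pi\beta}&0\end{pmatrix}\ \text{ for }\zeta\in IV,\qquad \Psi_\beta(\zeta)=\Psi(\zeta)\begin{pmatrix}1&-e^{-i\pi\beta\varepsilon}\\e^{i\pi\beta\varepsilon}&0\end{pmatrix}\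 \text{ for }\zeta\in V,$$ $$\Psi_\beta(\zeta)=\Psi(\zeta)\begin{pmatrix}0&-e^{-i\pi\beta}\\e^{i\pi\beta}&0\end{pmatrix}\ \text{ for }\zeta\in VI,$$ where $\varepsilon=1$ for $\Im\zeta>0$ and $\varepsilon=-1$ for $\Im\zeta<0$; that is, there is a solution of (a), (b) which is given by these formulas at all points off the contour and off the real axis (and so by continuity on the real axis). -/

import Mathlib

open Complex Filter Topology Matrix

/-!
## The confluent hypergeometric function on the universal covering of the punctured plane

The universal covering of the punctured plane is modelled by the complex plane of the variable `w`,
with covering map `w ↦ z = exp w`; thus `w = ln |z| + i arg z`, where `arg z` is any real number,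
and the deck transformation and the half turns `z ↦ e^{2πi} z`, `z ↦ e^{± iπ} z` are
`w ↦ w + 2πi` and `w ↦ w ± iπ`.
-/

/-- The derivative `d/dz` of a function on the universal covering, in the coordinate `w`,
`z = exp w`: one has `d/dz = exp (-w) d/dw`. -/
noncomputable def coverDeriv (F : ℂ → ℂ) (w : ℂ) : ℂ :=
  Complex.exp (-w) * deriv F w

/-- `F` is the confluent hypergeometric (Tricomi) function `ψ(a, c; z)`, `z = exp w`: it is analytic
on the universal covering of the punctured plane, solves the confluent hypergeometric equation
`z u'' + (c - z) u' - a u = 0` there, and satisfies `u(z) ~ z ^ (-a)` as `z → ∞` in the sector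
`-3π/2 < arg z < 3π/2`, uniformly in every smaller closed sector. -/
structure IsTricomi (a c : ℂ) (F : ℂ → ℂ) : Prop where
  differentiable : Differentiable ℂ F
  equation : ∀ w : ℂ,
    Complex.exp w * coverDeriv (coverDeriv F) w + (c - Complex.exp w) * coverDeriv F w
      - a * F w = 0
  asymptotics : ∀ δ : ℝ, 0 < δ →
    Tendsto (fun w : ℂ => Complex.exp (a * w) * F w)
      (comap Complex.re atTop ⊓ 𝓟 {w : ℂ | |w.im| ≤ 3 * Real.pi / 2 - δ}) (𝓝 1)

/-- The confluent hypergeometric (Tricomi) function `ψ(a, c; ·)` on the universal covering of the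
punctured plane, in the coordinate `w`, `z = exp w`. -/
noncomputable def tricomi (a c : ℂ) : ℂ → ℂ :=
  Classical.epsilon (IsTricomi a c)

/-!
## The explicit matrix functions
-/

/-- The value of `arg ζ` in `[0, 2π)` (for `ζ ≠ 0`). -/
noncomputable def argPos (ζ : ℂ) : ℝ :=
  if 0 ≤ Complex.arg ζ then Complex.arg ζ else Complex.arg ζ + 2 * Real.pi

/-- The point of the universal covering over `ζ ≠ 0` with `0 ≤ arg ζ < 2π`. -/
noncomputable def coverLift (ζ : ℂ) : ℂ :=
  (Real.log ‖ζ‖ : ℂ) + (argPos ζ : ℂ) * I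

/-- The matrix of confluent hypergeometric functions, as a function on the universal covering
(`z = exp w`). -/
noncomputable def hyperMatrix (β w : ℂ) : Matrix (Fin 2) (Fin 2) ℂ :=
  !![tricomi β 1 w * exp (2 * Real.pi * I * β) * exp (-exp w / 2),
     -tricomi (1 - β) 1 (w - Real.pi * I) * exp (Real.pi * I * β) * exp (exp w / 2)
        * (Complex.Gamma (1 - β) / Complex.Gamma β);
     -tricomi (1 + β) 1 w * exp (Real.pi * I * β) * exp (-exp w / 2)
        * (Complex.Gamma (1 + β) / Complex.Gamma (-β)),
     tricomi (-β) 1 (w - Real.pi * I) * exp (exp w / 2)]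

/-- The matrix function `Ψ(ζ)`, for `Im ζ > 0` (where `0 < arg ζ < π`) and for `Im ζ < 0` (where
`π < arg ζ < 2π`). Its values for real `ζ` are never used. -/
noncomputable def modelPsi (β ζ : ℂ) : Matrix (Fin 2) (Fin 2) ℂ :=
  if 0 < ζ.im then hyperMatrix β (coverLift ζ)
  else hyperMatrix β (coverLift ζ) * !![1, 0; 2 * I * Complex.sin (Real.pi * β), 1]

/-- `ε = 1` for `Im ζ > 0` and `ε = -1` for `Im ζ < 0`. -/
noncomputable def halfPlaneSign (ζ : ℂ) : ℂ :=
  if 0 < ζ.im then 1 else -1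

/-!
## The Riemann-Hilbert problem

The six rays leave the origin in the directions `arg ζ = π/2, θ₂, θ₃, 3π/2, θ₅, θ₆`, with
`π/2 < θ₂ < π < θ₃ < 3π/2 < θ₅ < 2π` and `0 < θ₆ < π/2`. The rays numbered 1, 2 and 6 are oriented
away from the origin, the rays numbered 3, 4 and 5 towards the origin.
-/

/-- The closed ray from the origin in the direction `arg ζ = θ`. -/
def contourRay (θ : ℝ) : Set ℂ :=
  {ζ : ℂ | ∃ r : ℝ, 0 ≤ r ∧ ζ = r * exp (θ * I)}

/-- The union of the six rays. -/
def contour (θ₂ θ₃ θ₅ θ₆ : ℝ) : Set ℂ :=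
  contourRay (Real.pi / 2) ∪ contourRay θ₂ ∪ contourRay θ₃ ∪ contourRay (3 * Real.pi / 2)
    ∪ contourRay θ₅ ∪ contourRay θ₆

/-- The open half-plane on the left of the line through the origin in the direction `θ`. -/
def leftSide (θ : ℝ) : Set ℂ := {ζ : ℂ | 0 < (ζ * exp (-(θ * I))).im}

/-- The open half-plane on the right of the line through the origin in the direction `θ`. -/
def rightSide (θ : ℝ) : Set ℂ := {ζ : ℂ | (ζ * exp (-(θ * I))).im < 0}

/-- `Y₊ = Y₋ J` on the ray in the direction `θ`, without the origin, oriented away from the origin: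
the `+` side is on the left of an observer who looks away from the origin. -/
def JumpOutward (Y : ℂ → Matrix (Fin 2) (Fin 2) ℂ) (θ : ℝ) (J : Matrix (Fin 2) (Fin 2) ℂ) : Prop :=
  ∀ r : ℝ, 0 < r → ∃ Yplus Yminus : Matrix (Fin 2) (Fin 2) ℂ,
    Tendsto Y (𝓝[leftSide θ] ((r : ℂ) * exp (θ * I))) (𝓝 Yplus) ∧
    Tendsto Y (𝓝[rightSide θ] ((r : ℂ) * exp (θ * I))) (𝓝 Yminus) ∧
    Yplus = Yminus * J

/-- `Y₊ = Y₋ J` on the ray in the direction `θ`, without the origin, oriented towards the origin: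
the `+` side is on the left of an observer who looks towards the origin. -/
def JumpInward (Y : ℂ → Matrix (Fin 2) (Fin 2) ℂ) (θ : ℝ) (J : Matrix (Fin 2) (Fin 2) ℂ) : Prop :=
  ∀ r : ℝ, 0 < r → ∃ Yplus Yminus : Matrix (Fin 2) (Fin 2) ℂ,
    Tendsto Y (𝓝[rightSide θ] ((r : ℂ) * exp (θ * I))) (𝓝 Yplus) ∧
    Tendsto Y (𝓝[leftSide θ] ((r : ℂ) * exp (θ * I))) (𝓝 Yminus) ∧
    Yplus = Yminus * J

/-- `Y` solves the Riemann-Hilbert problem with constant jump matrices on the six rays. -/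
structure IsModelRHPSolution (β : ℂ) (θ₂ θ₃ θ₅ θ₆ : ℝ) (Y : ℂ → Matrix (Fin 2) (Fin 2) ℂ) :
    Prop where
  analytic : ∀ i j : Fin 2, AnalyticOnNhd ℂ (fun ζ => Y ζ i j) (contour θ₂ θ₃ θ₅ θ₆)ᶜ
  jump₁ : JumpOutward Y (Real.pi / 2)
    !![0, exp (-(I * Real.pi * β)); -exp (I * Real.pi * β), 0]
  jump₂ : JumpOutward Y θ₂ !![1, 0; exp (I * Real.pi * β), 1]
  jump₃ : JumpInward Y θ₃ !![1, 0; exp (-(I * Real.pi * β)), 1]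
  jump₄ : JumpInward Y (3 * Real.pi / 2)
    !![0, exp (I * Real.pi * β); -exp (-(I * Real.pi * β)), 0]
  jump₅ : JumpInward Y θ₅ !![1, 0; exp (-(I * Real.pi * β)), 1]
  jump₆ : JumpOutward Y θ₆ !![1, 0; exp (I * Real.pi * β), 1]

/-- The sectorwise formulas for `Y` in terms of `Ψ`, at all points off the contour and off the real
axis. The sectors I to VI follow each other counterclockwise, starting with the sector I between the
first and the second ray; the sector V contains the positive semi-axis, where `arg ζ` jumps. -/
structure HasModelFormulas (β : ℂ) (θ₂ θ₃ θ₅ θ₆ : ℝ) (Y : ℂ → Matrix (Fin 2) (Fin 2) ℂ) :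
    Prop where
  sectorI : ∀ ζ : ℂ, Real.pi / 2 < argPos ζ → argPos ζ < θ₂ → Y ζ = modelPsi β ζ
  sectorII : ∀ ζ : ℂ, ζ.im ≠ 0 → θ₂ < argPos ζ → argPos ζ < θ₃ →
    Y ζ = modelPsi β ζ * !![1, 0; exp (I * Real.pi * β * halfPlaneSign ζ), 1]
  sectorIII : ∀ ζ : ℂ, θ₃ < argPos ζ → argPos ζ < 3 * Real.pi / 2 → Y ζ = modelPsi β ζ
  sectorIV : ∀ ζ : ℂ, 3 * Real.pi / 2 < argPos ζ → argPos ζ < θ₅ →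
    Y ζ = modelPsi β ζ * !![0, -exp (I * Real.pi * β); exp (-(I * Real.pi * β)), 0]
  sectorV : ∀ ζ : ℂ, ζ.im ≠ 0 → (θ₅ < argPos ζ ∨ argPos ζ < θ₆) →
    Y ζ = modelPsi β ζ * !![1, -exp (-(I * Real.pi * β * halfPlaneSign ζ));
      exp (I * Real.pi * β * halfPlaneSign ζ), 0]
  sectorVI : ∀ ζ : ℂ, θ₆ < argPos ζ → argPos ζ < Real.pi / 2 →
    Y ζ = modelPsi β ζ * !![0, -exp (-(I * Real.pi * β)); exp (I * Real.pi * β), 0]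

/-! With z = exp w one has z d/dz = d/dw, and the equation becomes u'' = e^w (u' + a u), whose
coefficients are entire in w. The Wronskian of two solutions is therefore C exp(exp w) with a
constant C, and the argument rests on computing such constants.

Uniqueness (`SolvesKummerOn.eqOn_of_tendsto`): for two solutions asymptotic to z^(-a) the Wronskian
times z^(2a) tends to 0 along the positive axis, whereas z^(2a) exp z is unbounded; so C = 0.
Existence: for Re a ≥ 1, Laplace integrals along the rays of direction φ, |φ| < π/2, are solutions
on |im w - φ| < π with the right asymptotics. Uniqueness identifies them, which yields the sector of
half-angle 3π/2. The Frobenius basis at the origin continues the solution to all w, and the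
contiguity relation `IsNormalizedTricomi.sub_one` carries existence to every a.

Connection: the behaviour at z = 0 shows that the Wronskian of ψ(a, ·) with the regular solution M
is e^z / Γ(a). Hence ψ(a, z) / Γ(1-a) - e^z ψ(1-a, e^(±iπ) z) / Γ(a) has zero Wronskian with M and
equals k_± M. As M is single-valued, so is each combination, and comparing growth at z → +∞ gives
e^(-iπa) k_+ = e^(iπa) k_-. For a = β and a = 1 + β these facts are the monodromy identity
`hyperMatrix_monodromy`.

Riemann-Hilbert problem: the solution is `hyperMatrix` at the lift of ζ times a right multiplier
that depends only on arg ζ and is constant in each sector. The six jumps become identities between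
constant matrices. The multiplier does not change across the negative axis; across the positive
axis, where arg ζ drops by 2π, analyticity is precisely the monodromy identity. -/

/-! ### The equation in the logarithmic coordinate; Wronskians -/

/-- `u`, with derivative `u'`, solves on `S` the confluent hypergeometric equation with parameters
`a` and `c = 1` in the logarithmic coordinate `w`, `z = exp w`. -/
def SolvesKummerOn (a : ℂ) (S : Set ℂ) (u u' : ℂ → ℂ) : Prop :=
  ∀ w ∈ S, HasDerivAt u (u' w) w ∧ HasDerivAt u' (exp w * (u' w + a * u w)) w

namespace SolvesKummerOn

variable {a : ℂ} {S T : Set ℂ} {u u' v v' : ℂ → ℂ}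

theorem mono (h : SolvesKummerOn a S u u') (hT : T ⊆ S) : SolvesKummerOn a T u u' :=
  fun w hw => h w (hT hw)

theorem linearCombination (hu : SolvesKummerOn a S u u') (hv : SolvesKummerOn a S v v')
    (c d : ℂ) :
    SolvesKummerOn a S (fun w => c * u w + d * v w) (fun w => c * u' w + d * v' w) := by
  intro w hw
  obtain ⟨h1, h2⟩ := hu w hw
  obtain ⟨h3, h4⟩ := hv w hw
  refine ⟨(h1.const_mul c).add (h3.const_mul d), ?_⟩
  exact ((h2.const_mul c).add (h4.const_mul d)).congr_deriv (by ring)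

/-- The equation gives W' = e^w W for the Wronskian W, so W exp(-exp w) has derivative zero. -/
theorem exists_wronskian_eq (hS : IsOpen S) (hS' : IsPreconnected S)
    (hu : SolvesKummerOn a S u u') (hv : SolvesKummerOn a S v v') :
    ∃ C : ℂ, ∀ w ∈ S, u w * v' w - u' w * v w = C * exp (exp w) := by
  have key : ∀ w ∈ S,
      HasDerivAt (fun w => (u w * v' w - u' w * v w) * exp (-exp w)) 0 w := by
    intro w hw
    obtain ⟨h1, h2⟩ := hu w hw
    obtain ⟨h3, h4⟩ := hv w hw
    have h5 : HasDerivAt (fun w => exp (-exp w)) (exp (-exp w) * (-exp w)) w :=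
      (Complex.hasDerivAt_exp w).neg.cexp
    exact (((h1.mul h4).sub (h2.mul h3)).mul h5).congr_deriv
      (by simp only [Pi.mul_apply, Pi.sub_apply]; ring)
  obtain ⟨C, hC⟩ := hS.exists_is_const_of_deriv_eq_zero hS'
    (fun w hw => (key w hw).differentiableAt.differentiableWithinAt)
    (fun w hw => (key w hw).deriv)
  refine ⟨C, fun w hw => ?_⟩
  rw [← hC w hw, mul_assoc, ← exp_add, neg_add_cancel, exp_zero, mul_one]

/-- Near w₀, where v has no zeros, u / v has derivative -W / v² = 0. The identity theorem then
carries the proportionality past the zeros of v. -/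
theorem eqOn_smul_of_wronskian_eq_zero (hS : IsOpen S) (hS' : IsPreconnected S)
    (hu : SolvesKummerOn a S u u') (hv : SolvesKummerOn a S v v')
    (hW : ∀ w ∈ S, u w * v' w - u' w * v w = 0) {w₀ : ℂ} (hw₀ : w₀ ∈ S) (hv₀ : v w₀ ≠ 0) :
    ∀ w ∈ S, u w = u w₀ / v w₀ * v w := by
  have hcont : ContinuousAt v w₀ := (hv w₀ hw₀).1.continuousAt
  obtain ⟨r, hr, hball⟩ := Metric.eventually_nhds_iff_ball.1
    ((hcont.eventually_ne hv₀).and (hS.mem_nhds hw₀))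
  have hderiv : ∀ w ∈ Metric.ball w₀ r, HasDerivAt (fun w => u w / v w) 0 w := by
    intro w hw
    obtain ⟨hne, hwS⟩ := hball w hw
    refine ((hu w hwS).1.div (hv w hwS).1 hne).congr_deriv ?_
    rw [div_eq_zero_iff]
    exact Or.inl (by linear_combination -hW w hwS)
  have hconst : ∀ w ∈ Metric.ball w₀ r, u w / v w = u w₀ / v w₀ := fun w hw =>
    Metric.isOpen_ball.is_const_of_deriv_eq_zero (convex_ball w₀ r).isPreconnected
      (fun w hw => (hderiv w hw).differentiableAt.differentiableWithinAt)
      (fun w hw => (hderiv w hw).deriv) hw (Metric.mem_ball_self hr)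
  have hua : AnalyticOnNhd ℂ u S := DifferentiableOn.analyticOnNhd
    (fun w hw => (hu w hw).1.differentiableAt.differentiableWithinAt) hS
  have hva : AnalyticOnNhd ℂ (fun w => u w₀ / v w₀ * v w) S := DifferentiableOn.analyticOnNhd
    (fun w hw => ((hv w hw).1.const_mul _).differentiableAt.differentiableWithinAt) hS
  refine hua.eqOn_of_preconnected_of_eventuallyEq hva hS' hw₀ ?_
  filter_upwards [Metric.ball_mem_nhds w₀ hr] with w hw
  rw [← hconst w hw, div_mul_cancel₀ _ (hball w hw).1]

end SolvesKummerOn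

/-! ### Uniqueness from the asymptotics at infinity -/

/-- Cauchy's estimate for G - c on discs of radius η, which stay in the wider strip; this is the
reason for the margin η. -/
theorem tendsto_deriv_of_tendsto_on_strip {G : ℂ → ℂ} {c : ℂ} {m T η : ℝ} (hη : 0 < η)
    {S : Set ℂ} (hS : {w : ℂ | |w.im - m| ≤ T + η} ⊆ S) (hG : ∀ w ∈ S, DifferentiableAt ℂ G w)
    (hlim : Tendsto G (comap Complex.re atTop ⊓ 𝓟 {w : ℂ | |w.im - m| ≤ T + η}) (𝓝 c)) :
    Tendsto (deriv G) (comap Complex.re atTop ⊓ 𝓟 {w : ℂ | |w.im - m| ≤ T}) (𝓝 0) := by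
  rw [Metric.tendsto_nhds]
  intro ε hε
  -- Cauchy's estimate divides by η, so this bound for G - c leaves ε / 2 for the derivative.
  have h1 := Metric.tendsto_nhds.1 hlim (ε / 2 * η) (by positivity)
  rw [eventually_inf_principal, eventually_comap] at h1
  rw [eventually_inf_principal, eventually_comap]
  obtain ⟨R, hR⟩ := eventually_atTop.1 h1
  filter_upwards [eventually_ge_atTop (R + η)] with x hx w hwx hw
  have hw : |w.im - m| ≤ T := hw
  have hsub : ∀ z ∈ Metric.closedBall w η, R ≤ z.re ∧ |z.im - m| ≤ T + η := by
    intro z hz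
    rw [mem_closedBall_iff_norm] at hz
    have h2 := (abs_re_le_norm (z - w)).trans hz
    have h3 := (abs_im_le_norm (z - w)).trans hz
    rw [sub_re, abs_le] at h2
    rw [sub_im] at h3
    refine ⟨by linarith [h2.1], ?_⟩
    calc |z.im - m| = |(z.im - w.im) + (w.im - m)| := by ring_nf
      _ ≤ |z.im - w.im| + |w.im - m| := abs_add_le _ _
      _ ≤ T + η := by linarith
  have hdiff : DiffContOnCl ℂ (fun z => G z - c) (Metric.ball w η) := by
    refine DifferentiableOn.diffContOnCl fun z hz => ?_
    have hz' := Metric.closure_ball_subset_closedBall hz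
    exact ((hG z (hS (hsub z hz').2)).sub_const c).differentiableWithinAt
  have := norm_deriv_le_of_forall_mem_sphere_norm_le hη hdiff (C := ε / 2 * η) (fun z hz => by
    have hz' := hsub z (Metric.sphere_subset_closedBall hz)
    have := hR z.re hz'.1 z rfl hz'.2
    rw [dist_eq_norm] at this
    exact this.le)
  rw [deriv_sub_const, mul_div_assoc, div_self hη.ne', mul_one] at this
  rw [dist_zero_right]
  linarith

theorem tendsto_ofReal_strip {η : ℝ} (hη : 0 ≤ η) :
    Tendsto (fun x : ℝ => (x : ℂ)) atTop
      (comap Complex.re atTop ⊓ 𝓟 {w : ℂ | |w.im - 0| ≤ η}) := by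
  rw [tendsto_inf, tendsto_comap_iff, tendsto_principal]
  exact ⟨tendsto_id, Eventually.of_forall fun x => by simpa using hη⟩

theorem tendsto_exp_mul_exp_exp_atTop (b : ℂ) :
    Tendsto (fun x : ℝ => ‖exp (b * x) * exp (exp (x : ℂ))‖) atTop atTop := by
  have h1 : ∀ x : ℝ, ‖exp (b * x) * exp (exp (x : ℂ))‖ = Real.exp (b.re * x + Real.exp x) := by
    intro x
    rw [norm_mul, norm_exp, norm_exp, ← Real.exp_add, re_mul_ofReal, ← ofReal_exp, ofReal_re]
  simp_rw [h1]
  refine Real.tendsto_exp_atTop.comp ?_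
  have h2 : Tendsto (fun x : ℝ => x * (b.re + Real.exp x / x)) atTop atTop := by
    refine tendsto_id.atTop_mul_atTop₀ (tendsto_atTop_add_const_left _ _ ?_)
    simpa using Real.tendsto_exp_div_pow_atTop 1
  refine h2.congr' ?_
  filter_upwards [eventually_gt_atTop 0] with x hx
  field_simp

/-- The derivative of the normalized solution `exp (a w) u` tends to zero on a smaller strip. -/
theorem SolvesKummerOn.tendsto_normalized_deriv {a : ℂ} {S : Set ℂ} {u u' : ℂ → ℂ}
    (hu : SolvesKummerOn a S u u') {m T η : ℝ} (hη : 0 < η) {c : ℂ}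
    (hS : {w : ℂ | |w.im - m| ≤ T + η} ⊆ S)
    (hlim : Tendsto (fun w => exp (a * w) * u w)
      (comap Complex.re atTop ⊓ 𝓟 {w : ℂ | |w.im - m| ≤ T + η}) (𝓝 c)) :
    Tendsto (fun w => exp (a * w) * (u' w + a * u w))
      (comap Complex.re atTop ⊓ 𝓟 {w : ℂ | |w.im - m| ≤ T}) (𝓝 0) := by
  have hd : ∀ w ∈ S,
      HasDerivAt (fun w => exp (a * w) * u w) (exp (a * w) * (u' w + a * u w)) w := by
    intro w hw
    have h1 : HasDerivAt (fun w => exp (a * w)) (exp (a * w) * (a * 1)) w :=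
      ((hasDerivAt_id w).const_mul a).cexp
    exact (h1.mul (hu w hw).1).congr_deriv (by ring)
  refine (tendsto_deriv_of_tendsto_on_strip hη hS
    (fun w hw => (hd w hw).differentiableAt) hlim).congr' ?_
  filter_upwards [mem_inf_of_right (mem_principal_self _)] with w hw
  have hw : |w.im - m| ≤ T := hw
  exact (hd w (hS (hw.trans (by linarith : T ≤ T + η)))).deriv

/-- The common asymptotics force the Wronskian to vanish, since its only possible form C exp(exp w)
grows faster than any power of z on the positive axis. The proportionality factor is then the
quotient of the two limits. -/
theorem SolvesKummerOn.eqOn_of_tendsto {a : ℂ} {S : Set ℂ} {u u' v v' : ℂ → ℂ}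
    (hSo : IsOpen S) (hSc : IsPreconnected S) (hu : SolvesKummerOn a S u u')
    (hv : SolvesKummerOn a S v v') {η : ℝ} (hη : 0 < η) (hS : {w : ℂ | |w.im - 0| ≤ η} ⊆ S)
    (hulim : Tendsto (fun w => exp (a * w) * u w)
      (comap Complex.re atTop ⊓ 𝓟 {w : ℂ | |w.im - 0| ≤ η}) (𝓝 1))
    (hvlim : Tendsto (fun w => exp (a * w) * v w)
      (comap Complex.re atTop ⊓ 𝓟 {w : ℂ | |w.im - 0| ≤ η}) (𝓝 1)) :
    ∀ w ∈ S, u w = v w := by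
  obtain ⟨C, hC⟩ := exists_wronskian_eq hSo hSc hu hv
  have hreal : ∀ x : ℝ, (x : ℂ) ∈ S := fun x => hS (by simpa using hη.le)
  have hu0 := hulim.comp (tendsto_ofReal_strip hη.le)
  have hv0 := hvlim.comp (tendsto_ofReal_strip hη.le)
  have hu1 := (hu.tendsto_normalized_deriv (m := 0) (T := 0) (c := 1) hη (by simpa using hS)
    (by simpa using hulim)).comp (tendsto_ofReal_strip le_rfl)
  have hv1 := (hv.tendsto_normalized_deriv (m := 0) (T := 0) (c := 1) hη (by simpa using hS)
    (by simpa using hvlim)).comp (tendsto_ofReal_strip le_rfl)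
  -- The Wronskian is u (v' + a v) - (u' + a u) v; after multiplication by exp(2 a x) it tends to 1
  -- · 0 - 0 · 1.
  have hW : Tendsto (fun x : ℝ => C * (exp (2 * a * x) * exp (exp (x : ℂ)))) atTop (𝓝 0) := by
    have h := (hu0.mul hv1).sub (hu1.mul hv0)
    rw [mul_zero, zero_mul, sub_zero] at h
    refine h.congr fun x => ?_
    have h2 : exp (2 * a * x) = exp (a * x) * exp (a * x) := by rw [← exp_add]; ring_nf
    simp only [Function.comp]
    rw [h2]
    linear_combination exp (a * x) * exp (a * x) * hC x (hreal x)
  have hC0 : C = 0 := by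
    by_contra hne
    have h1 := (tendsto_exp_mul_exp_exp_atTop (2 * a)).const_mul_atTop (norm_pos_iff.2 hne)
    have h2 := hW.norm
    simp_rw [norm_mul C] at h2
    exact not_tendsto_nhds_of_tendsto_atTop h1 _ h2
  subst hC0
  obtain ⟨x₀, hx₀⟩ := (hv0.eventually_ne one_ne_zero).exists
  have hvx : v x₀ ≠ 0 := fun h => hx₀ (by simp [h])
  have hprop := eqOn_smul_of_wronskian_eq_zero hSo hSc hu hv
    (fun w hw => by rw [hC w hw, zero_mul]) (hreal x₀) hvx
  have hc : u x₀ / v x₀ = 1 := by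
    have h1 := hv0.const_mul (u x₀ / v x₀)
    rw [mul_one] at h1
    refine tendsto_nhds_unique h1 (hu0.congr fun x => ?_)
    simp only [Function.comp]
    rw [hprop x (hreal x)]
    ring
  intro w hw
  rw [hprop w hw, hc, one_mul]

theorem isPreconnected_strip (m T : ℝ) : IsPreconnected {w : ℂ | |w.im - m| < T} := by
  refine Convex.isPreconnected ?_
  have : {w : ℂ | |w.im - m| < T} = Complex.imLm ⁻¹' (Metric.ball m T) := by
    ext w; simp [Real.dist_eq]
  rw [this]
  exact (convex_ball m T).is_linear_preimage Complex.imLm.isLinear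

theorem isOpen_strip (m T : ℝ) : IsOpen {w : ℂ | |w.im - m| < T} :=
  isOpen_lt (by fun_prop) continuous_const

theorem tendsto_exp_ofReal_atBot :
    Tendsto (fun x : ℝ => exp (x : ℂ)) atBot (𝓝 0) := by
  simp_rw [← ofReal_exp]
  exact (continuous_ofReal.tendsto' 0 0 ofReal_zero).comp Real.tendsto_exp_atBot

/-! ### Entire power series and the Frobenius solutions at the origin -/

/-- The sum of the power series with coefficients `c`. -/
noncomputable def seriesSum (c : ℕ → ℂ) (z : ℂ) : ℂ := ∑' n, c n * z ^ n

/-- The coefficients `c` belong to an everywhere convergent power series. -/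
def IsEntireCoeff (c : ℕ → ℂ) : Prop := ∀ r : ℝ, 0 ≤ r → Summable fun n => ‖c n‖ * r ^ n

namespace IsEntireCoeff

variable {c d : ℕ → ℂ}

theorem summable (hc : IsEntireCoeff c) (z : ℂ) : Summable fun n => c n * z ^ n :=
  Summable.of_norm (by simpa using hc ‖z‖ (norm_nonneg z))

theorem natCast_mul (hc : IsEntireCoeff c) : IsEntireCoeff fun n => n * c n := by
  intro r hr
  refine Summable.of_nonneg_of_le (fun n => by positivity) (fun n => ?_)
    (hc (2 * r) (by positivity))
  have h : (n : ℝ) ≤ 2 ^ n := by exact_mod_cast n.lt_two_pow_self.le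
  rw [norm_mul, Complex.norm_natCast, mul_pow]
  calc (n : ℝ) * ‖c n‖ * r ^ n ≤ 2 ^ n * ‖c n‖ * r ^ n := by gcongr
    _ = _ := by ring

theorem hasDerivAt_seriesSum_exp (hc : IsEntireCoeff c) (w : ℂ) :
    HasDerivAt (fun w => seriesSum c (exp w)) (seriesSum (fun n => n * c n) (exp w)) w := by
  -- On this half-plane |exp y| is bounded, so the differentiated series has a summable majorant.
  have hopen : IsOpen {y : ℂ | y.re < w.re + 1} := isOpen_lt continuous_re continuous_const
  have hconn : IsPreconnected {y : ℂ | y.re < w.re + 1} :=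
    (convex_halfSpace_re_lt (w.re + 1)).isPreconnected
  refine hasDerivAt_tsum_of_isPreconnected
    (hc.natCast_mul (Real.exp (w.re + 1)) (Real.exp_pos _).le) hopen hconn
    (g := fun n y => c n * exp y ^ n) (g' := fun n y => n * c n * exp y ^ n) (y₀ := w)
    (fun n y _ => ?_) (fun n y hy => ?_) (by simp) (hc.summable _) (by simp)
  · refine (((Complex.hasDerivAt_exp y).pow n).const_mul (c n)).congr_deriv ?_
    rcases n with _ | n
    · simp
    · simp only [Nat.add_sub_cancel]; ring
  · have hy : y.re < w.re + 1 := hy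
    rw [norm_mul, norm_pow, norm_exp]
    gcongr

theorem tendsto_seriesSum (hc : IsEntireCoeff c) : Tendsto (seriesSum c) (𝓝 0) (𝓝 (c 0)) := by
  have h0 : ∑' n, c n * (0 : ℂ) ^ n = c 0 := by
    rw [tsum_eq_single 0 (fun n hn => by simp [hn])]; simp
  rw [← h0]
  refine tendsto_tsum_of_dominated_convergence (bound := fun n => ‖c n‖ * 1 ^ n)
    (hc 1 zero_le_one) (fun n => (tendsto_id.pow n).const_mul _) ?_
  filter_upwards [Metric.closedBall_mem_nhds (0 : ℂ) one_pos] with z hz n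
  rw [mem_closedBall_zero_iff] at hz
  rw [norm_mul, norm_pow]
  gcongr

theorem tendsto_seriesSum_exp (hc : IsEntireCoeff c) :
    Tendsto (fun x : ℝ => seriesSum c (exp (x : ℂ))) atBot (𝓝 (c 0)) :=
  hc.tendsto_seriesSum.comp tendsto_exp_ofReal_atBot

theorem shift (hc : IsEntireCoeff c) : IsEntireCoeff fun n => c (n + 1) := by
  intro r hr
  have h := (summable_nat_add_iff 1).2 (hc (r + 1) (by positivity))
  refine Summable.of_nonneg_of_le (fun n => by positivity) (fun n => ?_) h
  have h1 : r ^ n ≤ (r + 1) ^ (n + 1) := by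
    calc r ^ n ≤ (r + 1) ^ n := by gcongr; linarith
      _ ≤ (r + 1) ^ (n + 1) := by gcongr <;> linarith
  gcongr

theorem seriesSum_eq (hc : IsEntireCoeff c) (h0 : c 0 = 0) (z : ℂ) :
    seriesSum c z = z * seriesSum (fun n => c (n + 1)) z := by
  rw [seriesSum, (hc.summable z).tsum_eq_zero_add, h0, zero_mul, zero_add, seriesSum,
    ← tsum_mul_left]
  exact tsum_congr fun n => by ring

theorem seriesSum_linear (hc : IsEntireCoeff c) (hd : IsEntireCoeff d) (s t z : ℂ) :
    seriesSum (fun n => s * c n + t * d n) z = s * seriesSum c z + t * seriesSum d z := by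
  simp only [seriesSum]
  rw [← tsum_mul_left, ← tsum_mul_left,
    ← ((hc.summable z).mul_left s).tsum_add ((hd.summable z).mul_left t)]
  exact tsum_congr fun n => by ring

end IsEntireCoeff

/-- The coefficients of the regular solution `M` of the confluent hypergeometric equation with
`c = 1`, and of the regular part of the logarithmic solution `M log z + ...`. -/
noncomputable def kummerCoeff (a : ℂ) : ℕ → ℂ × ℂ
  | 0 => (1, 0)
  | n + 1 =>
    ((n + a) * (kummerCoeff a n).1 / (n + 1) ^ 2,
      ((n + a) * (kummerCoeff a n).2 + (kummerCoeff a n).1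
        - 2 * (n + 1) * ((n + a) * (kummerCoeff a n).1 / (n + 1) ^ 2)) / (n + 1) ^ 2)

/-- The coefficient of z^(n+1) in M'' = z (M' + a M), the primes being w-derivatives. -/
theorem kummerCoeff_fst_succ (a : ℂ) (n : ℕ) :
    ((n + 1 : ℕ) : ℂ) * (((n + 1 : ℕ) : ℂ) * (kummerCoeff a (n + 1)).1)
      = n * (kummerCoeff a n).1 + a * (kummerCoeff a n).1 := by
  have h : (n : ℂ) + 1 ≠ 0 := n.cast_add_one_ne_zero
  simp only [kummerCoeff]
  push_cast
  field_simp

/-- The coefficient of z^(n+1) in S'' + 2 M' = z (S' + a S + M), which is the condition for w M + S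
to be a solution. -/
theorem kummerCoeff_snd_succ (a : ℂ) (n : ℕ) :
    ((n + 1 : ℕ) : ℂ) * (((n + 1 : ℕ) : ℂ) * (kummerCoeff a (n + 1)).2)
        + 2 * (((n + 1 : ℕ) : ℂ) * (kummerCoeff a (n + 1)).1)
      = n * (kummerCoeff a n).2 + a * (kummerCoeff a n).2 + (kummerCoeff a n).1 := by
  have h : (n : ℂ) + 1 ≠ 0 := n.cast_add_one_ne_zero
  simp only [kummerCoeff]
  push_cast
  field_simp
  ring

/-- The two sequences are estimated together because the first feeds the second. With A = |a| + 1,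
one step of the recursion multiplies the sum of the norms by at most (3 A + 1) / (n + 1): A comes
from the first component and 2 A + 1 from its contribution to the second. -/
theorem norm_kummerCoeff_le (a : ℂ) (n : ℕ) :
    ‖(kummerCoeff a n).1‖ + ‖(kummerCoeff a n).2‖
      ≤ (3 * (‖a‖ + 1) + 1) ^ n / (n.factorial : ℝ) := by
  induction n with
  | zero => simp [kummerCoeff]
  | succ n ih =>
    set A := ‖a‖ + 1 with hA
    set c := (kummerCoeff a n).1 with hc
    set d := (kummerCoeff a n).2 with hd
    have hA1 : 1 ≤ A := by rw [hA]; linarith [norm_nonneg a]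
    have hn : (0 : ℝ) < n + 1 := by positivity
    have hnorm : ‖(n : ℂ) + 1‖ = n + 1 := by
      rw [← Nat.cast_one, ← Nat.cast_add, Complex.norm_natCast]; push_cast; rfl
    have hna : ‖(n : ℂ) + a‖ ≤ A * (n + 1) := by
      refine (norm_add_le _ _).trans ?_
      rw [Complex.norm_natCast, hA]
      nlinarith [norm_nonneg a, (Nat.cast_nonneg n : (0 : ℝ) ≤ n)]
    have h1 : ‖(kummerCoeff a (n + 1)).1‖ ≤ A * ‖c‖ / (n + 1) := by
      simp only [kummerCoeff]
      rw [← hc, norm_div, norm_mul, norm_pow, hnorm, div_le_div_iff₀ (by positivity) hn]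
      have : ‖(n : ℂ) + a‖ * ‖c‖ ≤ A * (n + 1) * ‖c‖ := by gcongr
      nlinarith [mul_le_mul_of_nonneg_right this hn.le]
    have h2 : ‖(kummerCoeff a (n + 1)).2‖ ≤ (A * ‖d‖ + ‖c‖ + 2 * A * ‖c‖) / (n + 1) := by
      have h3 : (kummerCoeff a (n + 1)).2
          = ((n + a) * d + c - 2 * (n + 1) * (kummerCoeff a (n + 1)).1) / (n + 1) ^ 2 := by
        simp only [kummerCoeff]; rw [← hc, ← hd]
      rw [h3, norm_div, norm_pow, hnorm, div_le_div_iff₀ (by positivity) hn]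
      have h4 : ‖((n + a) * d + c - 2 * (n + 1) * (kummerCoeff a (n + 1)).1)‖
          ≤ A * (n + 1) * ‖d‖ + ‖c‖ * (n + 1) + 2 * (n + 1) * (A * ‖c‖ / (n + 1)) := by
        refine (norm_sub_le _ _).trans (add_le_add ((norm_add_le _ _).trans
          (add_le_add ?_ ?_)) ?_)
        · rw [norm_mul]; gcongr
        · nlinarith [norm_nonneg c, (Nat.cast_nonneg n : (0 : ℝ) ≤ n)]
        · rw [norm_mul, norm_mul, hnorm]
          simp only [Complex.norm_ofNat]
          gcongr
      have h5 : 2 * ((n : ℝ) + 1) * (A * ‖c‖ / (n + 1)) = 2 * A * ‖c‖ := by field_simp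
      rw [h5] at h4
      have h6 : 2 * A * ‖c‖ ≤ 2 * A * ‖c‖ * (n + 1) := by
        have : 0 ≤ 2 * A * ‖c‖ := by positivity
        nlinarith [(Nat.cast_nonneg n : (0 : ℝ) ≤ n)]
      nlinarith [mul_le_mul_of_nonneg_right (h4.trans (add_le_add_right h6 _)) hn.le]
    calc ‖(kummerCoeff a (n + 1)).1‖ + ‖(kummerCoeff a (n + 1)).2‖
        ≤ A * ‖c‖ / (n + 1) + (A * ‖d‖ + ‖c‖ + 2 * A * ‖c‖) / (n + 1) := add_le_add h1 h2
      _ ≤ (3 * A + 1) / (n + 1) * (‖c‖ + ‖d‖) := by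
          rw [← add_div, div_mul_eq_mul_div]
          gcongr
          nlinarith [norm_nonneg c, norm_nonneg d]
      _ ≤ (3 * A + 1) / (n + 1) * ((3 * A + 1) ^ n / (n.factorial : ℝ)) := by gcongr
      _ = (3 * A + 1) ^ (n + 1) / ((n + 1).factorial : ℝ) := by
          rw [Nat.factorial_succ]; push_cast; rw [pow_succ]; field_simp

theorem isEntireCoeff_of_norm_le {c : ℕ → ℂ} {K : ℝ}
    (h : ∀ n, ‖c n‖ ≤ K ^ n / (n.factorial : ℝ)) : IsEntireCoeff c := by
  intro r hr
  refine Summable.of_nonneg_of_le (fun n => by positivity) (fun n => ?_)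
    (Real.summable_pow_div_factorial (K * r))
  calc ‖c n‖ * r ^ n ≤ K ^ n / (n.factorial : ℝ) * r ^ n := by gcongr; exact h n
    _ = _ := by rw [mul_pow]; ring

theorem isEntireCoeff_kummerCoeff_fst (a : ℂ) : IsEntireCoeff fun n => (kummerCoeff a n).1 :=
  isEntireCoeff_of_norm_le fun n =>
    (le_add_of_nonneg_right (norm_nonneg _)).trans (norm_kummerCoeff_le a n)

theorem isEntireCoeff_kummerCoeff_snd (a : ℂ) : IsEntireCoeff fun n => (kummerCoeff a n).2 :=
  isEntireCoeff_of_norm_le fun n =>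
    (le_add_of_nonneg_left (norm_nonneg _)).trans (norm_kummerCoeff_le a n)

/-- Kummer's function `M(a, 1; z)`, `z = exp w`. -/
noncomputable def kummerM (a w : ℂ) : ℂ := seriesSum (fun n => (kummerCoeff a n).1) (exp w)

/-- The `w`-derivative of `kummerM`. -/
noncomputable def kummerMDeriv (a w : ℂ) : ℂ :=
  seriesSum (fun n => n * (kummerCoeff a n).1) (exp w)

theorem solvesKummerOn_kummerM (a : ℂ) :
    SolvesKummerOn a Set.univ (kummerM a) (kummerMDeriv a) := by
  intro w _
  have hc := isEntireCoeff_kummerCoeff_fst a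
  refine ⟨hc.hasDerivAt_seriesSum_exp w, ?_⟩
  refine (hc.natCast_mul.hasDerivAt_seriesSum_exp w).congr_deriv ?_
  rw [hc.natCast_mul.natCast_mul.seriesSum_eq (by simp)]
  simp_rw [kummerCoeff_fst_succ]
  have h := hc.natCast_mul.seriesSum_linear hc 1 a (exp w)
  simp only [one_mul] at h
  rw [h]
  rfl

theorem kummerM_add (a : ℂ) {c : ℂ} (hc : exp c = -1) (w : ℂ) :
    kummerM a (w + c) = seriesSum (fun n => (kummerCoeff a n).1) (-exp w) := by
  rw [kummerM, exp_add, hc, mul_neg_one]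

theorem kummerMDeriv_add (a : ℂ) {c : ℂ} (hc : exp c = -1) (w : ℂ) :
    kummerMDeriv a (w + c) = seriesSum (fun n => n * (kummerCoeff a n).1) (-exp w) := by
  rw [kummerMDeriv, exp_add, hc, mul_neg_one]

theorem kummerM_add_two_pi (a w : ℂ) : kummerM a (w + 2 * Real.pi * I) = kummerM a w := by
  rw [kummerM, kummerM, exp_add, exp_two_pi_mul_I, mul_one]

theorem tendsto_kummerM (a : ℂ) : Tendsto (fun x : ℝ => kummerM a x) atBot (𝓝 1) :=
  (isEntireCoeff_kummerCoeff_fst a).tendsto_seriesSum_exp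

theorem tendsto_exp_neg_mul_kummerMDeriv (a : ℂ) :
    Tendsto (fun x : ℝ => exp (-x) * kummerMDeriv a x) atBot (𝓝 a) := by
  have hc := (isEntireCoeff_kummerCoeff_fst a).natCast_mul
  have h := hc.shift.tendsto_seriesSum_exp
  simp only [zero_add, kummerCoeff] at h
  simp only [Nat.cast_zero, Nat.cast_one, zero_add, one_mul, mul_one, one_pow, div_one] at h
  refine h.congr fun x => ?_
  rw [kummerMDeriv, hc.seriesSum_eq (by simp), ← mul_assoc, ← exp_add, neg_add_cancel, exp_zero,
    one_mul]
  rfl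

theorem tendsto_kummerMDeriv (a : ℂ) : Tendsto (fun x : ℝ => kummerMDeriv a x) atBot (𝓝 0) := by
  have h := (isEntireCoeff_kummerCoeff_fst a).natCast_mul.tendsto_seriesSum_exp
  rwa [Nat.cast_zero, zero_mul] at h

/-- There is a second solution with Wronskian `exp z`. -/
theorem exists_second_solution (a : ℂ) :
    ∃ Q Q' : ℂ → ℂ, SolvesKummerOn a Set.univ Q Q' ∧
      ∀ w, kummerM a w * Q' w - kummerMDeriv a w * Q w = exp (exp w) := by
  have hc := isEntireCoeff_kummerCoeff_fst a
  have hd := isEntireCoeff_kummerCoeff_snd a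
  set S : ℂ → ℂ := fun w => seriesSum (fun n => (kummerCoeff a n).2) (exp w) with hS
  set S' : ℂ → ℂ := fun w => seriesSum (fun n => n * (kummerCoeff a n).2) (exp w) with hS'
  have hsol : SolvesKummerOn a Set.univ (fun w => w * kummerM a w + S w)
      (fun w => kummerM a w + w * kummerMDeriv a w + S' w) := by
    intro w hw
    obtain ⟨h1, h2⟩ := solvesKummerOn_kummerM a w hw
    have h3 : HasDerivAt S (S' w) w := hd.hasDerivAt_seriesSum_exp w
    -- The equation for S that remains when the terms with a factor w cancel.
    have h4 : HasDerivAt S' (exp w * (kummerM a w + S' w + a * S w) - 2 * kummerMDeriv a w) w := by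
      refine (hd.natCast_mul.hasDerivAt_seriesSum_exp w).congr_deriv ?_
      rw [eq_sub_iff_add_eq, kummerMDeriv]
      have h5 : IsEntireCoeff fun n : ℕ => 1 * ((n : ℂ) * (n * (kummerCoeff a n).2))
          + 2 * (n * (kummerCoeff a n).1) := by
        intro r hr
        refine Summable.of_nonneg_of_le (fun n => by positivity) (fun n => ?_)
          ((hd.natCast_mul.natCast_mul r hr).add ((hc.natCast_mul r hr).mul_left 2))
        calc _ ≤ (‖1 * ((n : ℂ) * (n * (kummerCoeff a n).2))‖
              + ‖2 * ((n : ℂ) * (kummerCoeff a n).1)‖) * r ^ n := by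
                gcongr; exact norm_add_le _ _
          _ = _ := by
                rw [one_mul, norm_mul 2]; simp only [Complex.norm_ofNat]; ring
      have h6 := hd.natCast_mul.natCast_mul.seriesSum_linear hc.natCast_mul 1 2 (exp w)
      rw [one_mul] at h6
      rw [← h6, h5.seriesSum_eq (by simp)]
      congr 1
      simp_rw [one_mul, kummerCoeff_snd_succ]
      have h7 := hd.natCast_mul.seriesSum_linear hd 1 a (exp w)
      have h8 : seriesSum (fun n => n * (kummerCoeff a n).2 + a * (kummerCoeff a n).2
          + (kummerCoeff a n).1) (exp w)
          = seriesSum (fun n => 1 * (n * (kummerCoeff a n).2) + a * (kummerCoeff a n).2) (exp w)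
            + seriesSum (fun n => (kummerCoeff a n).1) (exp w) := by
        simp only [seriesSum]
        have h9 : Summable fun n : ℕ =>
            (1 * (n * (kummerCoeff a n).2) + a * (kummerCoeff a n).2) * exp w ^ n := by
          refine (((hd.natCast_mul.summable (exp w)).mul_left 1).add
            ((hd.summable (exp w)).mul_left a)).congr fun n => ?_
          ring
        rw [← h9.tsum_add (hc.summable _)]
        exact tsum_congr fun n => by ring
      rw [h8, h7, kummerM]
      simp only [hS, hS']
      ring
    refine ⟨(((hasDerivAt_id w).mul h1).add h3).congr_deriv (by simp),
      ((h1.add ((hasDerivAt_id w).mul h2)).add h4).congr_deriv ?_⟩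
    simp only [id]
    ring
  refine ⟨_, _, hsol, ?_⟩
  obtain ⟨C, hC⟩ := SolvesKummerOn.exists_wronskian_eq isOpen_univ isPreconnected_univ
    (solvesKummerOn_kummerM a) hsol
  -- The terms with a factor w also cancel in the Wronskian, leaving M² + M S' - M' S, which tends
  -- to 1 as z → 0.
  suffices C = 1 by
    intro w
    rw [hC w trivial, this, one_mul]
  have hS0 : Tendsto (fun x : ℝ => S x) atBot (𝓝 0) := hd.tendsto_seriesSum_exp
  have hS1 : Tendsto (fun x : ℝ => S' x) atBot (𝓝 0) := by
    simpa using hd.natCast_mul.tendsto_seriesSum_exp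
  have hM := tendsto_kummerM a
  have h1 := ((hM.mul hM).add (hM.mul hS1)).sub ((tendsto_kummerMDeriv a).mul hS0)
  have hexp : Tendsto (fun x : ℝ => C * exp (exp (x : ℂ))) atBot (𝓝 (C * exp 0)) := by
    exact ((continuous_exp.tendsto 0).comp tendsto_exp_ofReal_atBot).const_mul _
  have h2 := tendsto_nhds_unique hexp (h1.congr fun x => by
    rw [← hC x trivial]; ring)
  simpa using h2

/-! ### Laplace type integrals -/

/-- The Laplace type integral `∫ exp (-r s) s ^ (p - 1) (s + ζ) ^ (-q) ds` over the positive
semi-axis. -/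
noncomputable def laplaceInt (r p q ζ : ℂ) : ℂ :=
  ∫ s in Set.Ioi (0 : ℝ), exp (-(r * s)) * (s : ℂ) ^ (p - 1) * ((s : ℂ) + ζ) ^ (-q)

theorem ofReal_add_mem_slitPlane {ζ : ℂ} (hζ : ζ ∈ slitPlane) {s : ℝ} (hs : 0 ≤ s) :
    (s : ℂ) + ζ ∈ slitPlane := by
  rw [mem_slitPlane_iff] at hζ ⊢
  rcases hζ with h | h
  · left; rw [add_re, ofReal_re]; linarith
  · right; rwa [add_im, ofReal_im, zero_add]

theorem norm_cpow_neg_le {x q : ℂ} {m : ℝ} (hm : 0 < m) (hx : m ≤ ‖x‖) (hq : 0 ≤ q.re) :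
    ‖x ^ (-q)‖ ≤ m ^ (-q.re) * Real.exp (Real.pi * |q.im|) := by
  have hx0 : x ≠ 0 := norm_pos_iff.1 (hm.trans_le hx)
  rw [norm_cpow_of_ne_zero hx0, div_eq_mul_inv, ← Real.exp_neg, neg_re, neg_im]
  gcongr ?_ * Real.exp ?_
  · exact Real.rpow_le_rpow_of_nonpos hm hx (by linarith)
  · rw [mul_neg, neg_neg]
    calc x.arg * q.im ≤ |x.arg * q.im| := le_abs_self _
      _ = |x.arg| * |q.im| := abs_mul _ _
      _ ≤ Real.pi * |q.im| := by gcongr; exact abs_arg_le_pi x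

theorem norm_exp_mul_cpow (r p : ℂ) {s : ℝ} (hs : 0 < s) :
    ‖exp (-(r * s)) * (s : ℂ) ^ (p - 1)‖ = s ^ (p.re - 1) * Real.exp (-r.re * s) := by
  rw [norm_mul, norm_exp, norm_cpow_eq_rpow_re_of_pos hs, neg_re, re_mul_ofReal, sub_re, one_re,
    mul_comm, neg_mul]

theorem integrableOn_laplaceBound {b σ : ℝ} (hb : 0 < b) (hσ : 0 < σ) :
    MeasureTheory.IntegrableOn (fun s : ℝ => s ^ (σ - 1) * Real.exp (-b * s)) (Set.Ioi 0) := by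
  simpa using integrableOn_rpow_mul_exp_neg_mul_rpow (p := 1) (s := σ - 1) (by linarith)
    one_pos hb

theorem continuousOn_laplaceWeight (r p : ℂ) :
    ContinuousOn (fun s : ℝ => exp (-(r * s)) * (s : ℂ) ^ (p - 1)) (Set.Ioi 0) := by
  refine ContinuousOn.mul (by fun_prop) ?_
  exact continuous_ofReal.continuousOn.cpow_const fun s hs => ofReal_mem_slitPlane.2 hs

theorem aestronglyMeasurable_laplaceWeight (r p : ℂ) :
    MeasureTheory.AEStronglyMeasurable (fun s : ℝ => exp (-(r * s)) * (s : ℂ) ^ (p - 1))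
      (MeasureTheory.volume.restrict (Set.Ioi 0)) :=
  (continuousOn_laplaceWeight r p).aestronglyMeasurable measurableSet_Ioi

theorem aestronglyMeasurable_laplaceKernel (r p q : ℂ) {ζ : ℂ} (hζ : ζ ∈ slitPlane) :
    MeasureTheory.AEStronglyMeasurable
      (fun s : ℝ => exp (-(r * s)) * (s : ℂ) ^ (p - 1) * ((s : ℂ) + ζ) ^ (-q))
      (MeasureTheory.volume.restrict (Set.Ioi 0)) := by
  refine ((continuousOn_laplaceWeight r p).mul ?_).aestronglyMeasurable measurableSet_Ioi
  exact (by fun_prop : ContinuousOn (fun s : ℝ => (s : ℂ) + ζ) _).cpow_const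
    fun s hs => ofReal_add_mem_slitPlane hζ (le_of_lt hs)

/-- Near a point of the slit plane, `s + ζ` is bounded away from zero uniformly in `s ≥ 0`. -/
theorem exists_ball_le_norm_add {ζ₀ : ℂ} (hζ₀ : ζ₀ ∈ slitPlane) :
    ∃ ε > 0, ∀ ζ ∈ Metric.ball ζ₀ ε, ζ ∈ slitPlane ∧ ∀ s : ℝ, 0 ≤ s → ε ≤ ‖(s : ℂ) + ζ‖ := by
  obtain ⟨R, hR, hball⟩ := Metric.isOpen_iff.1 isOpen_slitPlane ζ₀ hζ₀
  refine ⟨R / 2, by positivity, fun ζ hζ => ⟨hball (Metric.ball_subset_ball (by linarith) hζ),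
    fun s hs => ?_⟩⟩
  by_contra! hlt
  have hmem : -(s : ℂ) ∈ Metric.ball ζ₀ R := by
    rw [mem_ball_iff_norm] at hζ ⊢
    calc ‖-(s : ℂ) - ζ₀‖ = ‖(ζ - ζ₀) - (s + ζ)‖ := by ring_nf
      _ ≤ ‖ζ - ζ₀‖ + ‖(s : ℂ) + ζ‖ := norm_sub_le _ _
      _ < R := by linarith
  have := hball hmem
  rw [← ofReal_neg, ofReal_mem_slitPlane] at this
  linarith

theorem integrableOn_laplaceKernel {r p q ζ : ℂ} (hr : 0 < r.re) (hp : 0 < p.re) (hq : 0 ≤ q.re)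
    (hζ : ζ ∈ slitPlane) :
    MeasureTheory.IntegrableOn
      (fun s : ℝ => exp (-(r * s)) * (s : ℂ) ^ (p - 1) * ((s : ℂ) + ζ) ^ (-q)) (Set.Ioi 0) := by
  obtain ⟨ε, hε, h⟩ := exists_ball_le_norm_add hζ
  refine MeasureTheory.Integrable.mono'
    ((integrableOn_laplaceBound hr hp).mul_const (ε ^ (-q.re) * Real.exp (Real.pi * |q.im|)))
    (aestronglyMeasurable_laplaceKernel r p q hζ) ?_
  refine (MeasureTheory.ae_restrict_iff' measurableSet_Ioi).2 (Eventually.of_forall fun s hs => ?_)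
  have hs : 0 < s := hs
  rw [norm_mul, norm_exp_mul_cpow r p hs]
  gcongr
  exact norm_cpow_neg_le hε ((h ζ (Metric.mem_ball_self hε)).2 s hs.le) hq

theorem hasDerivAt_laplaceInt {r p q ζ : ℂ} (hr : 0 < r.re) (hp : 0 < p.re) (hq : 0 ≤ q.re)
    (hζ : ζ ∈ slitPlane) :
    HasDerivAt (laplaceInt r p q) (-q * laplaceInt r p (q + 1) ζ) ζ := by
  obtain ⟨ε, hε, h⟩ := exists_ball_le_norm_add hζ
  have hq1 : 0 ≤ (q + 1).re := by rw [add_re, one_re]; linarith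
  have key := hasDerivAt_integral_of_dominated_loc_of_deriv_le
    (μ := MeasureTheory.volume.restrict (Set.Ioi (0 : ℝ)))
    (F := fun ζ (s : ℝ) => exp (-(r * s)) * (s : ℂ) ^ (p - 1) * ((s : ℂ) + ζ) ^ (-q))
    (F' := fun ζ (s : ℝ) =>
      -q * (exp (-(r * s)) * (s : ℂ) ^ (p - 1) * ((s : ℂ) + ζ) ^ (-(q + 1))))
    (bound := fun s => ‖q‖ * (s ^ (p.re - 1) * Real.exp (-r.re * s) *
      (ε ^ (-(q + 1).re) * Real.exp (Real.pi * |(q + 1).im|))))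
    (Metric.ball_mem_nhds ζ hε)
    (by
      filter_upwards [isOpen_slitPlane.mem_nhds hζ] with y hy
      exact aestronglyMeasurable_laplaceKernel r p q hy)
    (integrableOn_laplaceKernel hr hp hq hζ)
    ((aestronglyMeasurable_laplaceKernel r p (q + 1) hζ).const_mul _)
    ((MeasureTheory.ae_restrict_iff' measurableSet_Ioi).2 (Eventually.of_forall
      fun s hs y hy => by
        have hs : 0 < s := hs
        rw [norm_mul, norm_neg, norm_mul, norm_exp_mul_cpow r p hs]
        gcongr
        exact norm_cpow_neg_le hε ((h y hy).2 s hs.le) hq1))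
    (((integrableOn_laplaceBound hr hp).mul_const _).const_mul _)
    ((MeasureTheory.ae_restrict_iff' measurableSet_Ioi).2 (Eventually.of_forall
      fun s hs y hy => by
        have hs : 0 < s := hs
        have h1 := ((hasDerivAt_id y).const_add (s : ℂ)).cpow_const (c := -q)
          (ofReal_add_mem_slitPlane (h y hy).1 hs.le)
        refine (h1.const_mul (exp (-(r * s)) * (s : ℂ) ^ (p - 1))).congr_deriv ?_
        rw [neg_add' q 1]
        simp only [id]
        ring))
  refine key.2.congr_deriv ?_
  rw [laplaceInt, ← MeasureTheory.integral_const_mul]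

/-- Splits off one factor s + ζ. Together with `laplaceInt_by_parts` it turns differentiation in ζ
into the confluent hypergeometric equation. -/
theorem laplaceInt_eq_add {r p q ζ : ℂ} (hr : 0 < r.re) (hp : 0 < p.re) (hq : 0 ≤ q.re)
    (hζ : ζ ∈ slitPlane) :
    laplaceInt r p q ζ = laplaceInt r (p + 1) (q + 1) ζ + ζ * laplaceInt r p (q + 1) ζ := by
  have hq1 : 0 ≤ (q + 1).re := by rw [add_re, one_re]; linarith
  have hp1 : 0 < (p + 1).re := by rw [add_re, one_re]; linarith
  rw [laplaceInt, laplaceInt, laplaceInt, ← MeasureTheory.integral_const_mul,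
    ← MeasureTheory.integral_add (integrableOn_laplaceKernel hr hp1 hq1 hζ)
      ((integrableOn_laplaceKernel hr hp hq1 hζ).const_mul ζ)]
  refine MeasureTheory.setIntegral_congr_fun measurableSet_Ioi fun s hs => ?_
  have hs : 0 < s := hs
  have hs0 : (s : ℂ) ≠ 0 := ofReal_ne_zero.2 hs.ne'
  have hne : (s : ℂ) + ζ ≠ 0 := slitPlane_ne_zero (ofReal_add_mem_slitPlane hζ hs.le)
  have h1 : (s : ℂ) ^ (p + 1 - 1) = s ^ (p - 1) * s := by
    rw [add_sub_right_comm, cpow_add _ _ hs0, cpow_one]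
  have h2 : ((s : ℂ) + ζ) ^ (-q) = (s + ζ) ^ (-(q + 1)) * (s + ζ) := by
    rw [neg_add', cpow_sub _ _ hne, cpow_one, div_mul_cancel₀ _ hne]
  rw [h1, h2]
  ring

/-- Integrates the derivative of e^(-rs) s^p (s + ζ)^(-q), which vanishes at both ends because Re p
> 0 and Re r > 0. -/
theorem laplaceInt_by_parts {r p q ζ : ℂ} (hr : 0 < r.re) (hp : 0 < p.re) (hq : 0 ≤ q.re)
    (hζ : ζ ∈ slitPlane) :
    r * laplaceInt r (p + 1) q ζ = p * laplaceInt r p q ζ - q * laplaceInt r (p + 1) (q + 1) ζ := by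
  have hq1 : 0 ≤ (q + 1).re := by rw [add_re, one_re]; linarith
  have hp1 : 0 < (p + 1).re := by rw [add_re, one_re]; linarith
  have hp0 : p ≠ 0 := fun h => by simp [h] at hp
  obtain ⟨ε, hε, hb⟩ := exists_ball_le_norm_add hζ
  have hI1 := (integrableOn_laplaceKernel hr hp1 hq hζ).const_mul (-r)
  have hI2 := (integrableOn_laplaceKernel hr hp hq hζ).const_mul p
  have hI3 := (integrableOn_laplaceKernel hr hp1 hq1 hζ).const_mul (-q)
  have hderiv : ∀ s ∈ Set.Ioi (0 : ℝ), HasDerivAt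
      (fun s : ℝ => exp (-(r * s)) * (s : ℂ) ^ p * ((s : ℂ) + ζ) ^ (-q))
      (-r * (exp (-(r * s)) * (s : ℂ) ^ (p + 1 - 1) * ((s : ℂ) + ζ) ^ (-q))
        + p * (exp (-(r * s)) * (s : ℂ) ^ (p - 1) * ((s : ℂ) + ζ) ^ (-q))
        + -q * (exp (-(r * s)) * (s : ℂ) ^ (p + 1 - 1) * ((s : ℂ) + ζ) ^ (-(q + 1)))) s := by
    intro s hs
    have hs : 0 < s := hs
    have h1 : HasDerivAt (fun y : ℂ => exp (-(r * y))) (exp (-(r * s)) * (-(r * 1))) s :=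
      ((hasDerivAt_id (s : ℂ)).const_mul r).neg.cexp
    have h2 : HasDerivAt (fun y : ℂ => y ^ p) (p * (s : ℂ) ^ (p - 1) * 1) s :=
      (hasDerivAt_id (s : ℂ)).cpow_const (ofReal_mem_slitPlane.2 hs)
    have h3 : HasDerivAt (fun y : ℂ => (y + ζ) ^ (-q)) (-q * ((s : ℂ) + ζ) ^ (-q - 1) * 1) s :=
      ((hasDerivAt_id (s : ℂ)).add_const ζ).cpow_const (ofReal_add_mem_slitPlane hζ hs.le)
    refine (((h1.mul h2).mul h3).comp_ofReal).congr_deriv ?_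
    simp only [Pi.mul_apply]
    rw [neg_add', add_sub_cancel_right]
    ring
  have hnorm : ∀ s : ℝ, 0 ≤ s →
      ‖exp (-(r * s)) * (s : ℂ) ^ p * ((s : ℂ) + ζ) ^ (-q)‖
        ≤ s ^ p.re * Real.exp (-r.re * s) * (ε ^ (-q.re) * Real.exp (Real.pi * |q.im|)) := by
    intro s hs
    have h1 := norm_cpow_neg_le hε ((hb ζ (Metric.mem_ball_self hε)).2 s hs) hq
    rw [norm_mul, norm_mul, norm_exp, norm_cpow_eq_rpow_re_of_nonneg hs hp.ne', neg_re,
      re_mul_ofReal, mul_comm (Real.exp _), neg_mul]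
    gcongr
  have hzero : exp (-(r * (0 : ℝ))) * ((0 : ℝ) : ℂ) ^ p * (((0 : ℝ) : ℂ) + ζ) ^ (-q) = 0 := by
    rw [ofReal_zero, zero_cpow hp0, mul_zero, zero_mul]
  have hcont : ContinuousWithinAt
      (fun s : ℝ => exp (-(r * s)) * (s : ℂ) ^ p * ((s : ℂ) + ζ) ^ (-q)) (Set.Ici 0) 0 := by
    rw [ContinuousWithinAt, hzero]
    have hlim : Tendsto (fun s : ℝ => s ^ p.re * Real.exp (-r.re * s)
        * (ε ^ (-q.re) * Real.exp (Real.pi * |q.im|))) (𝓝 0) (𝓝 0) := by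
      have h1 : ContinuousAt (fun s : ℝ => s ^ p.re) 0 :=
        Real.continuousAt_rpow_const _ _ (Or.inr hp.le)
      have h2 : ContinuousAt (fun s : ℝ => s ^ p.re * Real.exp (-r.re * s)
        * (ε ^ (-q.re) * Real.exp (Real.pi * |q.im|))) 0 :=
        (h1.mul (by fun_prop)).mul continuousAt_const
      have h3 := h2.tendsto
      simpa [Real.zero_rpow hp.ne'] using h3
    refine squeeze_zero_norm' ?_ (hlim.mono_left nhdsWithin_le_nhds)
    filter_upwards [self_mem_nhdsWithin] with s hs using hnorm s hs
  have htop : Tendsto (fun s : ℝ => exp (-(r * s)) * (s : ℂ) ^ p * ((s : ℂ) + ζ) ^ (-q))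
      atTop (𝓝 0) := by
    have h1 := (tendsto_rpow_mul_exp_neg_mul_atTop_nhds_zero p.re r.re hr).mul_const
      (ε ^ (-q.re) * Real.exp (Real.pi * |q.im|))
    rw [zero_mul] at h1
    refine squeeze_zero_norm' ?_ h1
    filter_upwards [eventually_ge_atTop 0] with s hs using hnorm s hs
  have hparts := MeasureTheory.integral_Ioi_of_hasDerivAt_of_tendsto hcont hderiv
    ((hI1.add hI2).add hI3) htop
  have hI12 := hI1.add hI2
  simp only [Pi.add_def] at hI12
  rw [MeasureTheory.integral_add hI12 hI3, MeasureTheory.integral_add hI1 hI2,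
    MeasureTheory.integral_const_mul, MeasureTheory.integral_const_mul,
    MeasureTheory.integral_const_mul, hzero, sub_zero] at hparts
  simp only [laplaceInt]
  linear_combination -hparts

/-- Euler's integral for the Gamma function, along a ray in the right half-plane. -/
theorem integral_exp_mul_cpow {p : ℂ} (hp : 0 < p.re) {r : ℂ} (hr : 0 < r.re) :
    r ^ p * ∫ s in Set.Ioi (0 : ℝ), exp (-(r * s)) * (s : ℂ) ^ (p - 1) = Gamma p := by
  -- For q = 0 the last factor is 1, so ζ = 1 is an arbitrary choice that makes the integration by
  -- parts available.
  have hone : ∀ r p : ℂ, ∫ s in Set.Ioi (0 : ℝ), exp (-(r * s)) * (s : ℂ) ^ (p - 1)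
      = laplaceInt r p 0 1 := by
    intro r p
    simp [laplaceInt]
  have hder : ∀ r : ℂ, 0 < r.re → HasDerivAt
      (fun r : ℂ => ∫ s in Set.Ioi (0 : ℝ), exp (-(r * s)) * (s : ℂ) ^ (p - 1))
      (-laplaceInt r (p + 1) 0 1) r := by
    intro r hr
    have hp1 : 0 < (p + 1).re := by rw [add_re, one_re]; linarith
    have hball : ∀ y ∈ Metric.ball r (r.re / 2), r.re / 2 < y.re := by
      intro y hy
      rw [mem_ball_iff_norm] at hy
      have := (abs_re_le_norm (y - r)).trans_lt hy
      rw [sub_re, abs_lt] at this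
      linarith [this.1]
    have key := hasDerivAt_integral_of_dominated_loc_of_deriv_le
      (μ := MeasureTheory.volume.restrict (Set.Ioi (0 : ℝ)))
      (F := fun r (s : ℝ) => exp (-(r * s)) * (s : ℂ) ^ (p - 1))
      (F' := fun r (s : ℝ) => -(exp (-(r * s)) * (s : ℂ) ^ (p + 1 - 1)))
      (bound := fun s => s ^ ((p + 1).re - 1) * Real.exp (-(r.re / 2) * s))
      (Metric.ball_mem_nhds r (half_pos hr))
      (Eventually.of_forall fun y => aestronglyMeasurable_laplaceWeight y p)
      (by
        have := integrableOn_laplaceKernel (q := 0) hr hp (by simp) one_mem_slitPlane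
        simpa [MeasureTheory.IntegrableOn] using this)
      (aestronglyMeasurable_laplaceWeight r (p + 1)).neg
      ((MeasureTheory.ae_restrict_iff' measurableSet_Ioi).2 (Eventually.of_forall
        fun s hs y hy => by
          have hs : 0 < s := hs
          rw [norm_neg, norm_exp_mul_cpow y (p + 1) hs]
          have := hball y hy
          gcongr))
      (integrableOn_laplaceBound (half_pos hr) hp1)
      ((MeasureTheory.ae_restrict_iff' measurableSet_Ioi).2 (Eventually.of_forall
        fun s hs y hy => by
          have hs : 0 < s := hs
          have hs0 : (s : ℂ) ≠ 0 := ofReal_ne_zero.2 hs.ne'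
          have h1 : HasDerivAt (fun y : ℂ => exp (-(y * s))) (exp (-(y * s)) * (-(1 * s))) y :=
            ((hasDerivAt_id y).mul_const (s : ℂ)).neg.cexp
          refine (h1.mul_const ((s : ℂ) ^ (p - 1))).congr_deriv ?_
          rw [add_sub_right_comm p 1 1, cpow_add _ _ hs0, cpow_one]
          ring))
    refine key.2.congr_deriv ?_
    rw [← hone, MeasureTheory.integral_neg]
  have hopen : IsOpen {r : ℂ | 0 < r.re} := isOpen_lt continuous_const continuous_re
  have hconn : IsPreconnected {r : ℂ | 0 < r.re} := (convex_halfSpace_re_gt 0).isPreconnected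
  -- By parts with q = 0, the left side does not depend on r in the half-plane; at r = 1 it is
  -- Euler's integral.
  have hconst : ∀ r ∈ {r : ℂ | 0 < r.re}, HasDerivAt (fun r : ℂ => r ^ p *
      ∫ s in Set.Ioi (0 : ℝ), exp (-(r * s)) * (s : ℂ) ^ (p - 1)) 0 r := by
    intro r hr
    have hr : 0 < r.re := hr
    have hr0 : r ≠ 0 := fun h => by simp [h] at hr
    have h1 : HasDerivAt (fun r : ℂ => r ^ p) (p * r ^ (p - 1) * 1) r :=
      (hasDerivAt_id r).cpow_const (mem_slitPlane_iff.2 (Or.inl hr))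
    refine (h1.mul (hder r hr)).congr_deriv ?_
    have h2 := laplaceInt_by_parts (q := 0) hr hp (by simp) one_mem_slitPlane
    rw [hone, cpow_sub _ _ hr0, cpow_one]
    field_simp
    linear_combination -r ^ p * h2
  rw [hopen.is_const_of_deriv_eq_zero hconn
    (fun w hw => (hconst w hw).differentiableAt.differentiableWithinAt)
    (fun w hw => (hconst w hw).deriv) hr (y := 1) (by simp), one_cpow, one_mul,
    Gamma_eq_integral hp, GammaIntegral]
  simp

/-! ### Sectorial solutions and their asymptotics -/

theorem log_exp_of_abs_im_lt {v : ℂ} (hv : |v.im| < Real.pi) : log (exp v) = v :=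
  log_exp (abs_lt.1 hv).1 (abs_lt.1 hv).2.le

theorem arg_exp_of_abs_im_lt {v : ℂ} (hv : |v.im| < Real.pi) : (exp v).arg = v.im := by
  rw [← log_im, log_exp_of_abs_im_lt hv]

theorem exp_mem_slitPlane_of_abs_im_lt {v : ℂ} (hv : |v.im| < Real.pi) : exp v ∈ slitPlane := by
  rw [mem_slitPlane_iff_arg, arg_exp_of_abs_im_lt hv]
  exact ⟨(abs_lt.1 hv).2.ne, exp_ne_zero v⟩

/-- The solution given by the Laplace integral along the ray in the direction `φ`, on the strip
of half-width `π` around `im w = φ`. -/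
noncomputable def sectorialSol (a : ℂ) (φ : ℝ) (w : ℂ) : ℂ :=
  (Gamma a)⁻¹ * laplaceInt (exp (φ * I)) a a (exp (w - φ * I))

/-- The `w`-derivative of `sectorialSol`. -/
noncomputable def sectorialSolDeriv (a : ℂ) (φ : ℝ) (w : ℂ) : ℂ :=
  -((Gamma a)⁻¹ * (exp (φ * I) * laplaceInt (exp (φ * I)) (a + 1) a (exp (w - φ * I))))

/-- The classical integral of e^(-zt) t^(a-1) (1+t)^(-a), with t = e^(iφ) s / z. Convergence needs
cos φ > 0, and s + z e^(-iφ) avoids the cut of the power when |im w - φ| < π. -/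
theorem solvesKummerOn_sectorialSol {a : ℂ} (ha : 0 < a.re) {φ : ℝ} (hφ : 0 < Real.cos φ) :
    SolvesKummerOn a {w : ℂ | |w.im - φ| < Real.pi} (sectorialSol a φ) (sectorialSolDeriv a φ) := by
  intro w hw
  have hr : 0 < (exp (φ * I)).re := by rwa [exp_ofReal_mul_I_re]
  have ha1 : 0 < (a + 1).re := by rw [add_re, one_re]; linarith
  have hv : |(w - φ * I).im| < Real.pi := by simpa using hw
  have hζ := exp_mem_slitPlane_of_abs_im_lt hv
  have hexp : HasDerivAt (fun w : ℂ => exp (w - φ * I)) (exp (w - φ * I) * 1) w :=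
    ((hasDerivAt_id w).sub_const _).cexp
  have hmul : exp w = exp (φ * I) * exp (w - φ * I) := by rw [← exp_add]; ring_nf
  have h1 := laplaceInt_eq_add hr ha ha.le hζ
  have h2 := laplaceInt_by_parts hr ha ha.le hζ
  constructor
  · refine (((hasDerivAt_laplaceInt hr ha ha.le hζ).comp w hexp).const_mul _).congr_deriv ?_
    rw [sectorialSolDeriv]
    linear_combination ((Gamma a)⁻¹ * a) * h1 + (Gamma a)⁻¹ * h2
  · refine ((((hasDerivAt_laplaceInt hr ha1 ha.le hζ).comp w hexp).const_mul _).const_mul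
      _).neg.congr_deriv ?_
    rw [sectorialSolDeriv, sectorialSol, hmul]
    linear_combination
      ((Gamma a)⁻¹ * (exp (φ * I) * exp (w - φ * I))) * h2

/-- The principal powers multiply because arg(1 + s e^(-v)) never has the sign of im v, so adding it
to im v does not leave (-π, π]. -/
theorem exp_mul_cpow_add_exp {a v : ℂ} (hv : |v.im| < Real.pi) {s : ℝ} (hs : 0 < s) :
    exp (a * v) * ((s : ℂ) + exp v) ^ (-a) = (1 + s * exp (-v)) ^ (-a) := by
  have hx : 1 + s * exp (-v) ∈ slitPlane := by
    rw [add_comm, ← div_mul_cancel₀ (s * exp (-v) + 1) (ofReal_ne_zero.2 hs.ne')]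
    have h1 := ofReal_add_mem_slitPlane (ζ := exp (-v))
      (exp_mem_slitPlane_of_abs_im_lt (by simpa using hv)) (inv_pos.2 hs).le
    have h2 : (s * exp (-v) + 1) / (s : ℂ) * s = ((s⁻¹ : ℝ) + exp (-v)) * s := by
      rw [ofReal_inv]
      have : (s : ℂ) ≠ 0 := ofReal_ne_zero.2 hs.ne'
      field_simp
      ring
    rw [h2]
    rw [mem_slitPlane_iff] at h1 ⊢
    rw [re_mul_ofReal, im_mul_ofReal]
    exact h1.imp (fun h => mul_pos h hs) fun h => mul_ne_zero h hs.ne'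
  have hx0 := slitPlane_ne_zero hx
  have hmul : (s : ℂ) + exp v = exp v * (1 + s * exp (-v)) := by
    rw [mul_add, mul_one, mul_left_comm, ← exp_add, add_neg_cancel, exp_zero]; ring
  have him : (1 + s * exp (-v)).im = -(s * (Real.exp (-v.re) * Real.sin v.im)) := by
    rw [add_im, one_im, im_ofReal_mul, exp_im, neg_re, neg_im, Real.sin_neg]; ring
  have hpos : 0 < s * Real.exp (-v.re) := by positivity
  obtain ⟨hl, hu⟩ := abs_lt.1 hv
  have harg : (exp v).arg + (1 + s * exp (-v)).arg ∈ Set.Ioc (-Real.pi) Real.pi := by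
    rw [arg_exp_of_abs_im_lt hv]
    have h1 := neg_pi_lt_arg (1 + s * exp (-v))
    have h2 := arg_le_pi (1 + s * exp (-v))
    rcases lt_trichotomy v.im 0 with h | h | h
    · have h3 : 0 ≤ (1 + s * exp (-v)).arg := by
        rw [arg_nonneg_iff, him]
        have := Real.sin_neg_of_neg_of_neg_pi_lt h hl
        nlinarith
      exact ⟨by linarith, by linarith⟩
    · rw [h]; exact ⟨by linarith, by linarith⟩
    · have h3 : (1 + s * exp (-v)).arg < 0 := by
        rw [arg_neg_iff, him]
        have := Real.sin_pos_of_pos_of_lt_pi h hu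
        nlinarith
      exact ⟨by linarith, by linarith⟩
  rw [hmul, cpow_def_of_ne_zero (mul_ne_zero (exp_ne_zero v) hx0), cpow_def_of_ne_zero hx0,
    (log_mul_eq_add_log_iff (exp_ne_zero v) hx0).2 harg, log_exp_of_abs_im_lt hv, ← exp_add]
  ring_nf

/-- With ρ = |s e^(-v)| the square of the norm is at least 1 - 2 ρ cos δ + ρ² = (ρ - cos δ)² + sin²
δ. This supplies a majorant uniform in the closed strip. -/
theorem sin_le_norm_one_add {v : ℂ} {δ : ℝ} (hδ : 0 < δ) (hδ' : δ < Real.pi)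
    (hv : |v.im| ≤ Real.pi - δ) {s : ℝ} (hs : 0 ≤ s) :
    Real.sin δ ≤ ‖1 + s * exp (-v)‖ := by
  have hsin : 0 < Real.sin δ := Real.sin_pos_of_pos_of_lt_pi hδ hδ'
  have hcos : -Real.cos δ ≤ Real.cos v.im := by
    rw [← Real.cos_pi_sub, ← Real.cos_abs v.im]
    exact Real.cos_le_cos_of_nonneg_of_le_pi (abs_nonneg _) (by linarith) hv
  have hρ : 0 ≤ s * Real.exp (-v.re) := by positivity
  refine (pow_le_pow_iff_left₀ hsin.le (norm_nonneg _) two_ne_zero).1 ?_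
  rw [← normSq_eq_norm_sq, normSq_apply, add_re, add_im, one_re, one_im, re_ofReal_mul,
    im_ofReal_mul, exp_re, exp_im, neg_re, neg_im, Real.cos_neg, Real.sin_neg]
  have h1 := Real.sin_sq_add_cos_sq δ
  have h2 := Real.sin_sq_add_cos_sq v.im
  have h3 := mul_le_mul_of_nonneg_left hcos hρ
  set ρ := s * Real.exp (-v.re)
  have h4 : (1 + s * (Real.exp (-v.re) * Real.cos v.im)) * (1 + s * (Real.exp (-v.re) *
      Real.cos v.im)) + (0 + s * (Real.exp (-v.re) * -Real.sin v.im)) * (0 + s *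
      (Real.exp (-v.re) * -Real.sin v.im)) = 1 + 2 * (ρ * Real.cos v.im) + ρ ^ 2 := by
    linear_combination ρ ^ 2 * h2
  rw [h4]
  nlinarith [sq_nonneg (ρ - Real.cos δ)]

/-- Once exp(a (w - iφ)) is absorbed into the integrand, dominated convergence gives the limit Γ(a)
r^(-a) with r = e^(iφ); the remaining factor exp(a i φ) equals r^a. -/
theorem tendsto_sectorialSol {a : ℂ} (ha : 0 < a.re) {φ : ℝ} (hφ : |φ| < Real.pi / 2) {δ : ℝ}
    (hδ : 0 < δ) (hδ' : δ < Real.pi) :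
    Tendsto (fun w => exp (a * w) * sectorialSol a φ w)
      (comap Complex.re atTop ⊓ 𝓟 {w : ℂ | |w.im - φ| ≤ Real.pi - δ}) (𝓝 1) := by
  have hφ' := abs_lt.1 hφ
  have hr : 0 < (exp (φ * I)).re := by
    rw [exp_ofReal_mul_I_re]; exact Real.cos_pos_of_mem_Ioo hφ'
  set r := exp (φ * I) with hrdef
  set l := comap Complex.re atTop ⊓ 𝓟 {w : ℂ | |w.im - φ| ≤ Real.pi - δ} with hl
  have hmem : ∀ᶠ w in l, |(w - φ * I).im| ≤ Real.pi - δ := by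
    filter_upwards [mem_inf_of_right (mem_principal_self _)] with w hw
    simpa using hw
  have hre : Tendsto (fun w : ℂ => w.re) l atTop := tendsto_inf_left tendsto_comap
  have hexp : Tendsto (fun w : ℂ => exp (-(w - φ * I))) l (𝓝 0) := by
    rw [tendsto_zero_iff_norm_tendsto_zero]
    have : ∀ w : ℂ, ‖exp (-(w - φ * I))‖ = Real.exp (-w.re) := fun w => by
      rw [norm_exp]; simp
    simp_rw [this]
    exact Real.tendsto_exp_neg_atTop_nhds_zero.comp hre
  have hmain : Tendsto (fun w : ℂ => ∫ s in Set.Ioi (0 : ℝ),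
      exp (-(r * s)) * (s : ℂ) ^ (a - 1) * (1 + s * exp (-(w - φ * I))) ^ (-a)) l
      (𝓝 (∫ s in Set.Ioi (0 : ℝ), exp (-(r * s)) * (s : ℂ) ^ (a - 1))) := by
    refine MeasureTheory.tendsto_integral_filter_of_dominated_convergence
      (fun s => s ^ (a.re - 1) * Real.exp (-r.re * s) *
        (Real.sin δ ^ (-a.re) * Real.exp (Real.pi * |a.im|))) ?_ ?_
      ((integrableOn_laplaceBound hr ha).mul_const _) ?_
    · filter_upwards [hmem] with w hw
      have hw' : |(w - φ * I).im| < Real.pi := by linarith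
      have h1 := (aestronglyMeasurable_laplaceKernel r a a
        (exp_mem_slitPlane_of_abs_im_lt hw')).const_mul (exp (a * (w - φ * I)))
      refine h1.congr ?_
      refine (MeasureTheory.ae_restrict_iff' measurableSet_Ioi).2 (Eventually.of_forall
        fun s hs => ?_)
      simp only
      rw [← exp_mul_cpow_add_exp hw' hs]
      ring
    · filter_upwards [hmem] with w hw
      refine (MeasureTheory.ae_restrict_iff' measurableSet_Ioi).2 (Eventually.of_forall
        fun s hs => ?_)
      have hs : 0 < s := hs
      rw [norm_mul, norm_exp_mul_cpow r a hs]
      gcongr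
      exact norm_cpow_neg_le (Real.sin_pos_of_pos_of_lt_pi hδ hδ')
        (sin_le_norm_one_add hδ hδ' hw hs.le) ha.le
    · refine Eventually.of_forall fun s => ?_
      have h1 : Tendsto (fun w : ℂ => 1 + s * exp (-(w - φ * I))) l (𝓝 1) := by
        simpa using (hexp.const_mul (s : ℂ)).const_add 1
      have h2 := ((continuousAt_cpow_const (b := -a) one_mem_slitPlane).tendsto.comp h1).const_mul
        (exp (-(r * s)) * (s : ℂ) ^ (a - 1))
      simpa using h2
  have hG0 : Gamma a ≠ 0 := Gamma_ne_zero_of_re_pos ha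
  have hlog : r ^ a = exp (a * (φ * I)) := by
    have hpi := Real.pi_pos
    rw [cpow_def_of_ne_zero (exp_ne_zero _),
      log_exp_of_abs_im_lt (by simpa using hφ.trans (by linarith)), mul_comm]
  have hlim := hmain.const_mul ((Gamma a)⁻¹ * exp (a * (φ * I)))
  rw [← hlog, mul_assoc, integral_exp_mul_cpow ha hr, inv_mul_cancel₀ hG0] at hlim
  refine hlim.congr' ?_
  filter_upwards [hmem] with w hw
  have hw' : |(w - φ * I).im| < Real.pi := by linarith
  have hsplit : exp (a * w) = exp (a * (φ * I)) * exp (a * (w - φ * I)) := by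
    rw [← exp_add]; ring_nf
  rw [sectorialSol, laplaceInt, hsplit, hlog]
  have : exp (a * (w - φ * I)) * ∫ s in Set.Ioi (0 : ℝ), exp (-(exp (φ * I) * s)) *
      (s : ℂ) ^ (a - 1) * ((s : ℂ) + exp (w - φ * I)) ^ (-a) = ∫ s in Set.Ioi (0 : ℝ),
      exp (-(r * s)) * (s : ℂ) ^ (a - 1) * (1 + s * exp (-(w - φ * I))) ^ (-a) := by
    rw [← MeasureTheory.integral_const_mul]
    refine MeasureTheory.setIntegral_congr_fun measurableSet_Ioi fun s hs => ?_
    rw [← exp_mul_cpow_add_exp hw' hs]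
    ring
  rw [← this]
  ring

/-! ### Behaviour of the Laplace integrals at the origin -/

theorem norm_cpow_mul_cpow_neg_le_one {a : ℂ} (ha : 0 ≤ a.re) {s t : ℝ} (hs : 0 < s) (ht : 0 ≤ t) :
    ‖(s : ℂ) ^ a * ((s : ℂ) + t) ^ (-a)‖ ≤ 1 := by
  rw [norm_mul, ← ofReal_add, norm_cpow_eq_rpow_re_of_pos hs,
    norm_cpow_eq_rpow_re_of_pos (by linarith), neg_re, Real.rpow_neg (by linarith),
    ← div_eq_mul_inv]
  exact div_le_one_of_le₀ (Real.rpow_le_rpow hs.le (by linarith) ha) (by positivity)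

theorem tendsto_ofReal_add_exp_cpow (a : ℂ) {s : ℝ} (hs : 0 < s) :
    Tendsto (fun x : ℝ => ((s : ℂ) + exp (x : ℂ)) ^ (-a)) atBot (𝓝 ((s : ℂ) ^ (-a))) := by
  refine (continuousAt_cpow_const (ofReal_mem_slitPlane.2 hs)).tendsto.comp ?_
  simpa using tendsto_exp_ofReal_atBot.const_add (s : ℂ)

/-- The integrand is dominated by e^(-s) and tends to it. Up to the factor -1 / Γ(a) this is the
limit of z ψ'(z) at 0. -/
theorem tendsto_laplaceInt_add_one {a : ℂ} (ha : 0 < a.re) :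
    Tendsto (fun x : ℝ => laplaceInt 1 (a + 1) a (exp (x : ℂ))) atBot (𝓝 1) := by
  have hone : ∫ s in Set.Ioi (0 : ℝ), exp (-(1 * s : ℂ)) * (s : ℂ) ^ ((1 : ℂ) - 1) = 1 := by
    have := integral_exp_mul_cpow (p := 1) (r := 1) (by simp) (by simp)
    rwa [one_cpow, one_mul, Gamma_one] at this
  suffices h : Tendsto (fun x : ℝ => laplaceInt 1 (a + 1) a (exp (x : ℂ))) atBot
      (𝓝 (∫ s in Set.Ioi (0 : ℝ), exp (-(1 * s : ℂ)) * (s : ℂ) ^ ((1 : ℂ) - 1))) by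
    rwa [hone] at h
  have hint := integrableOn_laplaceBound (b := 1) (σ := 1) one_pos one_pos
  refine MeasureTheory.tendsto_integral_filter_of_dominated_convergence
    (fun s => s ^ ((1 : ℝ) - 1) * Real.exp (-1 * s)) ?_ ?_ hint ?_
  · refine Eventually.of_forall fun x => ?_
    exact aestronglyMeasurable_laplaceKernel _ _ _ (exp_mem_slitPlane_of_abs_im_lt
      (by simpa using Real.pi_pos))
  · refine Eventually.of_forall fun x => ?_
    refine (MeasureTheory.ae_restrict_iff' measurableSet_Ioi).2 (Eventually.of_forall
      fun s hs => ?_)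
    have hs : 0 < s := hs
    have h1 := norm_cpow_mul_cpow_neg_le_one ha.le hs (Real.exp_pos x).le
    rw [ofReal_exp] at h1
    rw [add_sub_cancel_right, mul_assoc, norm_mul, sub_self, Real.rpow_zero, norm_exp]
    calc _ ≤ Real.exp (-(1 * (s : ℂ))).re * 1 :=
          mul_le_mul_of_nonneg_left h1 (Real.exp_pos _).le
      _ = _ := by simp
  · refine (MeasureTheory.ae_restrict_iff' measurableSet_Ioi).2 (Eventually.of_forall
      fun s hs => ?_)
    have hs : 0 < s := hs
    have h1 := (tendsto_ofReal_add_exp_cpow a hs).const_mul (exp (-(1 * s)) * (s : ℂ) ^ (a + 1 - 1))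
    have h2 : (s : ℂ) ^ (a + 1 - 1) * (s : ℂ) ^ (-a) = (s : ℂ) ^ ((1 : ℂ) - 1) := by
      rw [← cpow_add _ _ (ofReal_ne_zero.2 hs.ne')]; ring_nf
    rwa [mul_assoc, h2] at h1

/-- The factor z / (s + z) is at most 1 in modulus, and the remaining quotient (s / (s + z))^(a-1)
is bounded because Re a ≥ 1. -/
theorem tendsto_exp_mul_laplaceInt {a : ℂ} (ha : 1 ≤ a.re) :
    Tendsto (fun x : ℝ => exp (x : ℂ) * laplaceInt 1 a a (exp (x : ℂ))) atBot (𝓝 0) := by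
  have hzero : ∫ s in Set.Ioi (0 : ℝ), (0 : ℂ) = 0 := by simp
  rw [← hzero]
  simp_rw [laplaceInt, ← MeasureTheory.integral_const_mul]
  have hint := integrableOn_laplaceBound (b := 1) (σ := 1) one_pos one_pos
  refine MeasureTheory.tendsto_integral_filter_of_dominated_convergence
    (fun s => s ^ ((1 : ℝ) - 1) * Real.exp (-1 * s)) ?_ ?_ hint ?_
  · refine Eventually.of_forall fun x => ?_
    exact (aestronglyMeasurable_laplaceKernel _ _ _ (exp_mem_slitPlane_of_abs_im_lt
      (by simpa using Real.pi_pos))).const_mul _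
  · refine Eventually.of_forall fun x => ?_
    refine (MeasureTheory.ae_restrict_iff' measurableSet_Ioi).2 (Eventually.of_forall
      fun s hs => ?_)
    have hs : 0 < s := hs
    have ht := Real.exp_pos x
    have hst : (0 : ℝ) < s + Real.exp x := by linarith
    have h1 := norm_cpow_mul_cpow_neg_le_one (a := a - 1) (by simpa using ha) hs ht.le
    rw [ofReal_exp] at h1
    have hne : (s : ℂ) + exp x ≠ 0 := by
      rw [← ofReal_exp, ← ofReal_add]; exact ofReal_ne_zero.2 hst.ne'
    have h2 : ((s : ℂ) + exp x) ^ (-a) = ((s : ℂ) + exp x) ^ (-(a - 1)) / ((s : ℂ) + exp x) := by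
      rw [neg_sub, sub_eq_add_neg, cpow_add _ _ hne, cpow_one]; field_simp
    have h3 : ‖exp (x : ℂ) / ((s : ℂ) + exp x)‖ ≤ 1 := by
      rw [← ofReal_exp, ← ofReal_add, ← ofReal_div, norm_real, Real.norm_eq_abs,
        abs_of_pos (by positivity)]
      exact div_le_one_of_le₀ (by linarith) hst.le
    calc ‖exp (x : ℂ) * (exp (-(1 * s)) * (s : ℂ) ^ (a - 1) * ((s : ℂ) + exp x) ^ (-a))‖
        = ‖exp (-(1 * (s : ℂ)))‖ * ‖(s : ℂ) ^ (a - 1) * ((s : ℂ) + exp x) ^ (-(a - 1))‖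
            * ‖exp (x : ℂ) / ((s : ℂ) + exp x)‖ := by
          rw [← norm_mul, ← norm_mul, h2]; ring_nf
      _ ≤ ‖exp (-(1 * (s : ℂ)))‖ * 1 * 1 := by gcongr
      _ = _ := by rw [norm_exp]; simp
  · refine (MeasureTheory.ae_restrict_iff' measurableSet_Ioi).2 (Eventually.of_forall
      fun s hs => ?_)
    have h1 := tendsto_exp_ofReal_atBot.mul ((tendsto_ofReal_add_exp_cpow a hs).const_mul
      (exp (-(1 * s)) * (s : ℂ) ^ (a - 1)))
    rwa [zero_mul] at h1

/-! ### Existence and uniqueness of the Tricomi function -/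

/-- `F`, with `w`-derivative `F'`, solves the confluent hypergeometric equation on the whole
universal covering, is normalized as the Tricomi function, and has the logarithmic behaviour
`-log z / Γ(a)` of the Tricomi function at the origin. -/
structure IsNormalizedTricomi (a : ℂ) (F F' : ℂ → ℂ) : Prop where
  solves : SolvesKummerOn a Set.univ F F'
  asymptotics : ∀ δ : ℝ, 0 < δ → Tendsto (fun w : ℂ => exp (a * w) * F w)
    (comap Complex.re atTop ⊓ 𝓟 {w : ℂ | |w.im - 0| ≤ 3 * Real.pi / 2 - δ}) (𝓝 1)
  deriv_atBot : Tendsto (fun x : ℝ => F' x) atBot (𝓝 (-(Gamma a)⁻¹))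
  exp_mul_atBot : Tendsto (fun x : ℝ => exp (x : ℂ) * F x) atBot (𝓝 0)

/-- A solution on a strip extends to the whole universal covering. -/
theorem SolvesKummerOn.exists_extension {a : ℂ} {S : Set ℂ} (hS : IsOpen S)
    (hS' : IsPreconnected S) {u u' : ℂ → ℂ} (hu : SolvesKummerOn a S u u') :
    ∃ F F' : ℂ → ℂ, SolvesKummerOn a Set.univ F F' ∧ ∀ w ∈ S, F w = u w ∧ F' w = u' w := by
  obtain ⟨Q, Q', hQ, hMQ⟩ := exists_second_solution a
  have hM := solvesKummerOn_kummerM a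
  obtain ⟨c₁, h₁⟩ := exists_wronskian_eq hS hS' hu (hM.mono (Set.subset_univ S))
  obtain ⟨c₂, h₂⟩ := exists_wronskian_eq hS hS' hu (hQ.mono (Set.subset_univ S))
  -- Cramer's rule: the coefficients are the Wronskians of u with Q and M, and that of M and Q is
  -- exp(exp w).
  refine ⟨_, _, hM.linearCombination hQ c₂ (-c₁), fun w hw => ?_⟩
  have hne := exp_ne_zero (exp w)
  have e1 := h₁ w hw
  have e2 := h₂ w hw
  have e3 := hMQ w
  constructor
  · refine mul_right_cancel₀ hne ?_
    linear_combination (u w) * e3 - (kummerM a w) * e2 + (Q w) * e1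
  · refine mul_right_cancel₀ hne ?_
    linear_combination (u' w) * e3 - (kummerMDeriv a w) * e2 + (Q' w) * e1

theorem exists_isNormalizedTricomi_of_one_le_re {a : ℂ} (ha : 1 ≤ a.re) :
    ∃ F F' : ℂ → ℂ, IsNormalizedTricomi a F F' := by
  have ha0 : 0 < a.re := by linarith
  have hpi := Real.pi_pos
  obtain ⟨F, F', hF, hEq⟩ := (solvesKummerOn_sectorialSol ha0 (φ := 0) (by simp)).exists_extension
    (isOpen_strip _ _) (isPreconnected_strip _ _)
  have hreal : ∀ x : ℝ, (x : ℂ) ∈ {w : ℂ | |w.im - (0 : ℝ)| < Real.pi} := fun x => by simpa using hpi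
  have hlim0 : Tendsto (fun w => exp (a * w) * F w)
      (comap Complex.re atTop ⊓ 𝓟 {w : ℂ | |w.im - 0| ≤ Real.pi / 4}) (𝓝 1) := by
    have h := tendsto_sectorialSol ha0 (φ := 0) (by simpa using half_pos hpi)
      -- This leaves the half-width π / 4, small enough for the strip to lie in |im w - φ| < π for
      -- all |φ| < π / 2.
      (δ := 3 * Real.pi / 4) (by positivity) (by linarith)
    rw [show Real.pi - 3 * Real.pi / 4 = Real.pi / 4 by ring] at h
    refine h.congr' ?_
    filter_upwards [mem_inf_of_right (mem_principal_self _)] with w hw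
    have hw : |w.im - 0| ≤ Real.pi / 4 := hw
    rw [(hEq w (show |w.im - 0| < Real.pi by linarith)).1]
  have hsect : ∀ φ : ℝ, |φ| < Real.pi / 2 → ∀ η : ℝ, 0 < η → η < Real.pi →
      Tendsto (fun w => exp (a * w) * F w)
        (comap Complex.re atTop ⊓ 𝓟 {w : ℂ | |w.im - φ| ≤ Real.pi - η}) (𝓝 1) := by
    intro φ hφ η hη hη'
    have hsub : ∀ w : ℂ, |w.im - 0| ≤ Real.pi / 4 → |w.im - φ| ≤ Real.pi - Real.pi / 4 := by
      intro w hw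
      rw [sub_zero] at hw
      have := abs_sub w.im φ
      linarith
    -- Both solutions are normalized on the common strip around the real axis, so the integral along
    -- the rotated ray continues F.
    have heq := SolvesKummerOn.eqOn_of_tendsto (isOpen_strip φ Real.pi)
      (isPreconnected_strip φ Real.pi)
      (solvesKummerOn_sectorialSol ha0 (Real.cos_pos_of_mem_Ioo (abs_lt.1 hφ)))
      (hF.mono (Set.subset_univ _)) (η := Real.pi / 4) (by positivity)
      (fun w hw => show |w.im - φ| < Real.pi by linarith [hsub w hw])
      ((tendsto_sectorialSol ha0 hφ (δ := Real.pi / 4) (by positivity) (by linarith)).mono_left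
        (inf_le_inf_left _ (principal_mono.2 hsub))) hlim0
    refine (tendsto_sectorialSol ha0 hφ hη hη').congr' ?_
    filter_upwards [mem_inf_of_right (mem_principal_self _)] with w hw
    have hw : |w.im - φ| ≤ Real.pi - η := hw
    rw [heq w (show |w.im - φ| < Real.pi by linarith)]
  refine ⟨F, F', hF, fun δ hδ => ?_, ?_, ?_⟩
  -- The strips around ±(π/2 - η) of half-width π - η reach up to ±(3π/2 - 2η) and together cover
  -- the required one, since 2η ≤ δ.
  · set η := min δ (Real.pi / 4) / 2 with hη
    have hη0 : 0 < η := by positivity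
    have hη1 : 2 * η ≤ δ := by rw [hη]; linarith [min_le_left δ (Real.pi / 4)]
    have hη2 : 2 * η ≤ Real.pi / 4 := by rw [hη]; linarith [min_le_right δ (Real.pi / 4)]
    have h1 := hsect (Real.pi / 2 - η) (by rw [abs_lt]; constructor <;> linarith) η hη0
      (by linarith)
    have h2 := hsect (-(Real.pi / 2 - η)) (by rw [abs_lt]; constructor <;> linarith) η hη0
      (by linarith)
    refine (h1.sup h2).mono_left ?_
    rw [← inf_sup_left, sup_principal]
    refine inf_le_inf_left _ (principal_mono.2 fun w hw => ?_)
    have hw : |w.im - 0| ≤ 3 * Real.pi / 2 - δ := hw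
    rw [sub_zero, abs_le] at hw
    rcases le_total 0 w.im with h | h
    · left; rw [Set.mem_ofPred_eq, abs_le]; constructor <;> linarith [hw.1, hw.2]
    · right; rw [Set.mem_ofPred_eq, abs_le]; constructor <;> linarith [hw.1, hw.2]
  · have h := ((tendsto_laplaceInt_add_one ha0).const_mul (Gamma a)⁻¹).neg
    rw [mul_one] at h
    refine h.congr fun x => ?_
    rw [(hEq x (hreal x)).2, sectorialSolDeriv]
    simp
  · have h := (tendsto_exp_mul_laplaceInt ha).const_mul (Gamma a)⁻¹
    rw [mul_zero] at h
    refine h.congr fun x => ?_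
    rw [(hEq x (hreal x)).1, sectorialSol]
    simp only [ofReal_zero, zero_mul, exp_zero, sub_zero]
    ring

theorem tendsto_exp_neg_comap_re (s : Set ℂ) :
    Tendsto (fun w : ℂ => exp (-w)) (comap Complex.re atTop ⊓ 𝓟 s) (𝓝 0) := by
  rw [tendsto_zero_iff_norm_tendsto_zero]
  simp_rw [norm_exp, neg_re]
  exact Real.tendsto_exp_neg_atTop_nhds_zero.comp (tendsto_inf_left tendsto_comap)

/-- The contiguity relation which lowers the parameter `a` by one. -/
theorem IsNormalizedTricomi.sub_one {a : ℂ} {F F' : ℂ → ℂ} (h : IsNormalizedTricomi a F F') :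
    IsNormalizedTricomi (a - 1) (fun w => (exp w + (a - 1)) * F w - F' w)
      (fun w => (a - 1) * (F' w - exp w * F w)) where
  solves := by
    intro w hw
    obtain ⟨h1, h2⟩ := h.solves w hw
    have he := Complex.hasDerivAt_exp w
    refine ⟨(((he.add_const (a - 1)).mul h1).sub h2).congr_deriv (by ring),
      ((h2.sub (he.mul h1)).const_mul (a - 1)).congr_deriv (by ring)⟩
  asymptotics := by
    intro δ hδ
    have h1 := h.asymptotics δ hδ
    have h2 := h.solves.tendsto_normalized_deriv (m := 0) (T := 3 * Real.pi / 2 - δ) (c := 1)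
      (half_pos hδ) (Set.subset_univ _) (by
        rw [show 3 * Real.pi / 2 - δ + δ / 2 = 3 * Real.pi / 2 - δ / 2 by ring]
        exact h.asymptotics (δ / 2) (half_pos hδ))
    -- The new normalized function is e^(aw) F + e^(-w) ((2a - 1) e^(aw) F - e^(aw) (F' + a F)), and
    -- the bracket stays bounded.
    have h3 := h1.add ((tendsto_exp_neg_comap_re _).mul ((h1.const_mul (2 * a - 1)).sub h2))
    rw [zero_mul, add_zero] at h3
    refine h3.congr fun w => ?_
    have h4 : exp ((a - 1) * w) = exp (a * w) * exp (-w) := by rw [← exp_add]; ring_nf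
    have h5 : exp (-w) * exp w = 1 := by rw [← exp_add, neg_add_cancel, exp_zero]
    rw [h4]
    linear_combination (-exp (a * w) * F w) * h5
  deriv_atBot := by
    have h1 := (h.deriv_atBot.sub h.exp_mul_atBot).const_mul (a - 1)
    -- 1 / Γ(a-1) = (a-1) / Γ(a) holds at the poles too, with the value 1 / Γ = 0 there.
    have h2 := one_div_Gamma_eq_self_mul_one_div_Gamma_add_one (a - 1)
    rw [sub_add_cancel] at h2
    rwa [sub_zero, mul_neg, ← h2] at h1
  exp_mul_atBot := by
    have h1 := ((tendsto_exp_ofReal_atBot.mul h.exp_mul_atBot).add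
      (h.exp_mul_atBot.const_mul (a - 1))).sub (tendsto_exp_ofReal_atBot.mul h.deriv_atBot)
    simp only [mul_zero, zero_mul, add_zero, sub_zero] at h1
    exact h1.congr fun x => by ring

theorem exists_isNormalizedTricomi (a : ℂ) : ∃ F F' : ℂ → ℂ, IsNormalizedTricomi a F F' := by
  have key : ∀ (n : ℕ) (a : ℂ), 1 ≤ a.re + n → ∃ F F' : ℂ → ℂ, IsNormalizedTricomi a F F' := by
    intro n
    induction n with
    | zero => exact fun a ha => exists_isNormalizedTricomi_of_one_le_re (by simpa using ha)
    | succ n ih =>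
      intro a ha
      obtain ⟨F, F', h⟩ := ih (a + 1) (by rw [add_re, one_re]; push_cast at ha; linarith)
      have h1 := h.sub_one
      rw [add_sub_cancel_right] at h1
      exact ⟨_, _, h1⟩
  obtain ⟨n, hn⟩ := exists_nat_ge (1 - a.re)
  exact key n a (by linarith)

theorem IsTricomi.solves {a : ℂ} {F : ℂ → ℂ} (h : IsTricomi a 1 F) :
    SolvesKummerOn a Set.univ F (deriv F) := by
  intro w _
  have hd : HasDerivAt (deriv F) (deriv (deriv F) w) w :=
    ((h.differentiable.differentiableOn (s := Set.univ)).deriv isOpen_univ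
      |>.differentiableAt univ_mem).hasDerivAt
  refine ⟨(h.differentiable w).hasDerivAt, hd.congr_deriv ?_⟩
  have he : HasDerivAt (fun w : ℂ => exp (-w)) (exp (-w) * (-1)) w := (hasDerivAt_id w).neg.cexp
  have h1 : deriv (coverDeriv F) w = exp (-w) * (-1) * deriv F w + exp (-w) * deriv (deriv F) w :=
    (he.mul hd).deriv
  have h2 := h.equation w
  rw [coverDeriv, h1, coverDeriv] at h2
  have h5 : exp (-w) * exp w = 1 := by rw [← exp_add, neg_add_cancel, exp_zero]
  linear_combination exp w * h2 - (deriv (deriv F) w) * (1 + exp (-w) * exp w) * h5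
    + (deriv F w) * h5 * (exp (-w) * exp w + exp w)

theorem IsNormalizedTricomi.isTricomi {a : ℂ} {F F' : ℂ → ℂ} (h : IsNormalizedTricomi a F F') :
    IsTricomi a 1 F where
  differentiable := fun w => (h.solves w trivial).1.differentiableAt
  equation := by
    intro w
    have hF' : deriv F = F' := funext fun w => (h.solves w trivial).1.deriv
    have he : HasDerivAt (fun w : ℂ => exp (-w)) (exp (-w) * (-1)) w := (hasDerivAt_id w).neg.cexp
    have h1 : deriv (coverDeriv F) w
        = exp (-w) * (-1) * F' w + exp (-w) * (exp w * (F' w + a * F w)) := by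
      have h2 : coverDeriv F = fun w => exp (-w) * F' w := by
        funext w; rw [coverDeriv, hF']
      rw [h2]
      exact (he.mul (h.solves w trivial).2).deriv
    rw [coverDeriv, h1, coverDeriv, hF']
    have h5 : exp (-w) * exp w = 1 := by rw [← exp_add, neg_add_cancel, exp_zero]
    linear_combination
      (-exp (-w) * F' w + (exp (-w) * exp w + 1) * (F' w + a * F w) - F' w) * h5
  asymptotics := fun δ hδ => by simpa using h.asymptotics δ hδ

theorem IsTricomi.unique {a : ℂ} {F G : ℂ → ℂ} (hF : IsTricomi a 1 F) (hG : IsTricomi a 1 G) :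
    F = G := by
  have hpi := Real.pi_pos
  have hlim : ∀ {F : ℂ → ℂ}, IsTricomi a 1 F → Tendsto (fun w => exp (a * w) * F w)
      (comap Complex.re atTop ⊓ 𝓟 {w : ℂ | |w.im - 0| ≤ Real.pi}) (𝓝 1) := by
    intro F hF
    have := hF.asymptotics (Real.pi / 2) (by positivity)
    rw [show 3 * Real.pi / 2 - Real.pi / 2 = Real.pi by ring] at this
    simpa using this
  exact funext fun w => SolvesKummerOn.eqOn_of_tendsto isOpen_univ isPreconnected_univ hF.solves
    hG.solves hpi (Set.subset_univ _) (hlim hF) (hlim hG) w trivial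

theorem existsUnique_isTricomi (a : ℂ) : ∃! F : ℂ → ℂ, IsTricomi a 1 F := by
  obtain ⟨F, F', h⟩ := exists_isNormalizedTricomi a
  exact ⟨F, h.isTricomi, fun G hG => hG.unique h.isTricomi⟩

theorem isTricomi_tricomi (a : ℂ) : IsTricomi a 1 (tricomi a 1) :=
  Classical.epsilon_spec (existsUnique_isTricomi a).exists

/-- The behaviour at the origin is not part of `IsTricomi`; uniqueness transfers it from the
constructed solution. -/
theorem isNormalizedTricomi_tricomi (a : ℂ) :
    IsNormalizedTricomi a (tricomi a 1) (deriv (tricomi a 1)) := by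
  obtain ⟨F, F', h⟩ := exists_isNormalizedTricomi a
  rw [(isTricomi_tricomi a).unique h.isTricomi,
    show deriv F = F' from funext fun w => (h.solves w trivial).1.deriv]
  exact h

/-! ### Connection formulas and monodromy -/

theorem matrix_fin_two_congr {a b c d a' b' c' d' : ℂ} (h₁ : a = a') (h₂ : b = b') (h₃ : c = c')
    (h₄ : d = d') : !![a, b; c, d] = !![a', b'; c', d'] := by
  rw [h₁, h₂, h₃, h₄]

theorem exists_kummerM_ne_zero (a : ℂ) : ∃ x : ℝ, kummerM a x ≠ 0 :=
  ((tendsto_kummerM a).eventually_ne one_ne_zero).exists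

/-- The solution of the equation with parameter `a` obtained from a solution with parameter
`1 - a` by Kummer's transformation, `c` being a logarithm of `-1`. -/
theorem SolvesKummerOn.kummerTransform {a c : ℂ} (hc : exp c = -1) {F F' : ℂ → ℂ}
    (hF : SolvesKummerOn (1 - a) Set.univ F F') :
    SolvesKummerOn a Set.univ (fun w => exp (exp w) * F (w + c))
      (fun w => exp (exp w) * (exp w * F (w + c) + F' (w + c))) := by
  intro w _
  have hadd : HasDerivAt (fun w : ℂ => w + c) 1 w := (hasDerivAt_id w).add_const c
  have h1 := (hF (w + c) trivial).1.comp w hadd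
  have h2 := (hF (w + c) trivial).2.comp w hadd
  have he := Complex.hasDerivAt_exp w
  rw [exp_add, hc] at h2
  refine ⟨(he.cexp.mul h1).congr_deriv ?_, (he.cexp.mul ((he.mul h1).add h2)).congr_deriv ?_⟩
  · simp only [Function.comp]; ring
  · simp only [Function.comp, Pi.add_apply, Pi.mul_apply]; ring

/-- The constant is read off at z → 0. As F itself may have a logarithm there, F M' is grouped as (z
F)(M' / z) → 0 · a, while F' M → -1 / Γ(a). -/
theorem IsNormalizedTricomi.wronskian_kummerM {a : ℂ} {F F' : ℂ → ℂ}
    (h : IsNormalizedTricomi a F F') (w : ℂ) :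
    F w * kummerMDeriv a w - F' w * kummerM a w = (Gamma a)⁻¹ * exp (exp w) := by
  obtain ⟨C, hC⟩ := SolvesKummerOn.exists_wronskian_eq isOpen_univ isPreconnected_univ h.solves
    (solvesKummerOn_kummerM a)
  rw [hC w trivial]
  congr 1
  have h1 := (h.exp_mul_atBot.mul (tendsto_exp_neg_mul_kummerMDeriv a)).sub
    (h.deriv_atBot.mul (tendsto_kummerM a))
  have h2 : Tendsto (fun x : ℝ => C * exp (exp (x : ℂ))) atBot (𝓝 (C * exp 0)) :=
    ((continuous_exp.tendsto 0).comp tendsto_exp_ofReal_atBot).const_mul C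
  have h3 := tendsto_nhds_unique h2 (h1.congr fun x => by
    rw [← hC x trivial]
    have : exp (x : ℂ) * exp (-x : ℂ) = 1 := by rw [← exp_add, add_neg_cancel, exp_zero]
    linear_combination (F x * kummerMDeriv a x) * this)
  simpa using h3

/-- Kummer's transformation of the regular solution. -/
theorem exp_mul_kummerM_add {a c : ℂ} (hc : exp c = -1) (w : ℂ) :
    exp (exp w) * kummerM (1 - a) (w + c) = kummerM a w := by
  have hN := (solvesKummerOn_kummerM (1 - a)).kummerTransform hc
  have hM := solvesKummerOn_kummerM a
  have hc1 := isEntireCoeff_kummerCoeff_fst (1 - a)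
  have hneg : Tendsto (fun x : ℝ => -exp (x : ℂ)) atBot (𝓝 0) := by
    simpa using tendsto_exp_ofReal_atBot.neg
  have hexp : Tendsto (fun x : ℝ => exp (exp (x : ℂ))) atBot (𝓝 1) := by
    have := (continuous_exp.tendsto 0).comp tendsto_exp_ofReal_atBot
    rwa [exp_zero] at this
  have hK : Tendsto (fun x : ℝ => kummerM (1 - a) (x + c)) atBot (𝓝 1) := by
    simp_rw [kummerM_add _ hc]
    exact hc1.tendsto_seriesSum.comp hneg
  have hK' : Tendsto (fun x : ℝ => kummerMDeriv (1 - a) (x + c)) atBot (𝓝 0) := by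
    simp_rw [kummerMDeriv_add _ hc]
    have := hc1.natCast_mul.tendsto_seriesSum.comp hneg
    rwa [Nat.cast_zero, zero_mul] at this
  have hN1 := hexp.mul hK
  have hN2 := hexp.mul ((tendsto_exp_ofReal_atBot.mul hK).add hK')
  obtain ⟨C, hC⟩ := SolvesKummerOn.exists_wronskian_eq isOpen_univ isPreconnected_univ hN hM
  -- At z → 0 both solutions tend to 1 and both w-derivatives to 0, so the Wronskian tends to 0.
  have hC0 : C = 0 := by
    have h1 := (hN1.mul (tendsto_kummerMDeriv a)).sub (hN2.mul (tendsto_kummerM a))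
    have h2 := tendsto_nhds_unique (hexp.const_mul C) (h1.congr fun x => hC x trivial)
    simpa using h2
  obtain ⟨x₀, hx₀⟩ := exists_kummerM_ne_zero a
  have hprop := SolvesKummerOn.eqOn_smul_of_wronskian_eq_zero isOpen_univ isPreconnected_univ hN hM
    (fun w hw => by rw [hC w hw, hC0, zero_mul]) (w₀ := x₀) trivial hx₀
  have hk := tendsto_nhds_unique hN1 (((tendsto_kummerM a).const_mul _).congr
    fun x => (hprop x trivial).symm)
  rw [one_mul, mul_one] at hk
  rw [hprop w trivial, ← hk, one_mul]

/-- Kummer's transformation applied to M as well reduces this to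
`IsNormalizedTricomi.wronskian_kummerM` at w + c. -/
theorem IsNormalizedTricomi.wronskian_kummerTransform {a c : ℂ} (hc : exp c = -1) {F F' : ℂ → ℂ}
    (h : IsNormalizedTricomi (1 - a) F F') (w : ℂ) :
    exp (exp w) * F (w + c) * kummerMDeriv a w
      - exp (exp w) * (exp w * F (w + c) + F' (w + c)) * kummerM a w
      = (Gamma (1 - a))⁻¹ * exp (exp w) := by
  have hN := ((solvesKummerOn_kummerM (1 - a)).kummerTransform hc w trivial).1
  have hfun : (fun w => exp (exp w) * kummerM (1 - a) (w + c)) = kummerM a :=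
    funext fun w => exp_mul_kummerM_add hc w
  rw [hfun] at hN
  rw [(solvesKummerOn_kummerM a w trivial).1.unique hN, ← exp_mul_kummerM_add hc w]
  have h1 := h.wronskian_kummerM (w + c)
  rw [exp_add w c, hc, mul_neg_one] at h1
  have h2 : exp (exp w) * exp (-exp w) = 1 := by rw [← exp_add, add_neg_cancel, exp_zero]
  linear_combination (exp (exp w)) ^ 2 * h1 + (Gamma (1 - a))⁻¹ * exp (exp w) * h2

/-- The connection formula, up to the constant factor. -/
theorem exists_connection {a c : ℂ} (hc : exp c = -1) :
    ∃ k : ℂ, ∀ w, (Gamma (1 - a))⁻¹ * tricomi a 1 w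
      + -(Gamma a)⁻¹ * (exp (exp w) * tricomi (1 - a) 1 (w + c)) = k * kummerM a w := by
  have h := isNormalizedTricomi_tricomi a
  have h' := isNormalizedTricomi_tricomi (1 - a)
  have hX := h.solves.linearCombination (h'.solves.kummerTransform hc) (Gamma (1 - a))⁻¹
    (-(Gamma a)⁻¹)
  obtain ⟨x₀, hx₀⟩ := exists_kummerM_ne_zero a
  -- The weights are chosen so that the Wronskians with M, proportional to 1 / Γ(a) and 1 / Γ(1-a),
  -- cancel.
  have hprop := SolvesKummerOn.eqOn_smul_of_wronskian_eq_zero isOpen_univ isPreconnected_univ hX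
    (solvesKummerOn_kummerM a) (fun w _ => by
      linear_combination (Gamma (1 - a))⁻¹ * h.wronskian_kummerM w
        + -(Gamma a)⁻¹ * h'.wronskian_kummerTransform hc w) (w₀ := x₀) trivial hx₀
  exact ⟨_, fun w => hprop w trivial⟩

/-- After multiplication by z^(1-a) e^(-z) the term ψ(a, z) is negligible at +∞, and the other
contributes the phase of c. The factor of k does not involve c, so two choices of c can be compared
without knowing the growth of M. -/
theorem tendsto_connection {a c : ℂ} (hcim : |c.im| < 3 * Real.pi / 2)
    (hcre : c.re = 0) {k : ℂ}
    (hk : ∀ w, (Gamma (1 - a))⁻¹ * tricomi a 1 w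
      + -(Gamma a)⁻¹ * (exp (exp w) * tricomi (1 - a) 1 (w + c)) = k * kummerM a w) :
    Tendsto (fun x : ℝ => k * (exp ((1 - a) * x) * exp (-exp (x : ℂ)) * kummerM a x)) atTop
      (𝓝 (-(Gamma a)⁻¹ * exp (-((1 - a) * c)))) := by
  have hpi := Real.pi_pos
  have h1 : Tendsto (fun x : ℝ => exp (a * x) * tricomi a 1 x) atTop (𝓝 1) := by
    have := ((isNormalizedTricomi_tricomi a).asymptotics (Real.pi / 2) (by positivity)).comp
      (tendsto_ofReal_strip (by linarith))
    exact this
  have h2 : Tendsto (fun x : ℝ => exp ((1 - a) * (x + c)) * tricomi (1 - a) 1 (x + c)) atTop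
      (𝓝 1) := by
    refine ((isNormalizedTricomi_tricomi (1 - a)).asymptotics (3 * Real.pi / 2 - |c.im|)
      (by linarith)).comp (f := fun x : ℝ => (x : ℂ) + c) ?_
    rw [tendsto_inf, tendsto_comap_iff, tendsto_principal]
    refine ⟨?_, Eventually.of_forall fun x => by simp⟩
    simp only [Function.comp_def, add_re, ofReal_re, hcre, add_zero]
    exact tendsto_id
  have h3 : Tendsto (fun x : ℝ => exp ((1 - 2 * a) * x) * exp (-exp (x : ℂ))) atTop (𝓝 0) := by
    rw [tendsto_zero_iff_norm_tendsto_zero]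
    refine (tendsto_exp_mul_exp_exp_atTop (2 * a - 1)).inv_tendsto_atTop.congr fun x => ?_
    rw [Pi.inv_apply, ← norm_inv, mul_inv, ← exp_neg, ← exp_neg]
    ring_nf
  have h4 := ((h3.mul h1).const_mul (Gamma (1 - a))⁻¹).add
    (h2.const_mul (-(Gamma a)⁻¹ * exp (-((1 - a) * c))))
  simp only [mul_zero, zero_add, mul_one] at h4
  refine h4.congr fun x => ?_
  have e1 : exp ((1 - a) * x) = exp ((1 - 2 * a) * x) * exp (a * x) := by
    rw [← exp_add]; ring_nf
  have e2 : exp ((1 - a) * (x + c)) * exp (-((1 - a) * c)) = exp ((1 - a) * x) := by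
    rw [← exp_add]; ring_nf
  have e3 : exp (-exp (x : ℂ)) * exp (exp (x : ℂ)) = 1 := by
    rw [← exp_add, neg_add_cancel, exp_zero]
  linear_combination (exp ((1 - a) * x) * exp (-exp (x : ℂ))) * hk x
    - (Gamma (1 - a))⁻¹ * exp (-exp (x : ℂ)) * tricomi a 1 x * e1
    - (Gamma a)⁻¹ * tricomi (1 - a) 1 (x + c) * e2
    + (Gamma a)⁻¹ * tricomi (1 - a) 1 (x + c) * exp ((1 - a) * x) * e3

/-- The single-valued combination of two Tricomi functions. -/
noncomputable def tricomiComb (a w : ℂ) : ℂ :=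
  (Gamma (1 - a))⁻¹ * tricomi a 1 w
    - (Gamma a)⁻¹ * (exp (exp w) * tricomi (1 - a) 1 (w - Real.pi * I))

theorem tricomiComb_add_two_pi (a w : ℂ) :
    tricomiComb a (w + 2 * Real.pi * I) = tricomiComb a w := by
  obtain ⟨k, hk⟩ := exists_connection (a := a) exp_neg_pi_mul_I
  have h : ∀ w, tricomiComb a w = k * kummerM a w := fun w => by
    rw [← hk w, tricomiComb]; ring_nf
  rw [h, h, kummerM_add_two_pi]

/-- The two combinations are k M and l M, for c = -iπ and c = iπ. Computing the limit of k l times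
the common factor in two ways gives l e^(-iπa) = k e^(iπa). -/
theorem exp_mul_tricomiComb (a w : ℂ) :
    exp (Real.pi * I * a) * tricomiComb a w = exp (-(Real.pi * I * a)) *
      ((Gamma (1 - a))⁻¹ * tricomi a 1 w
        - (Gamma a)⁻¹ * (exp (exp w) * tricomi (1 - a) 1 (w + Real.pi * I))) := by
  have hpi := Real.pi_pos
  obtain ⟨k, hk⟩ := exists_connection (a := a) exp_neg_pi_mul_I
  obtain ⟨l, hl⟩ := exists_connection (a := a) exp_pi_mul_I
  have him : |Real.pi| < 3 * Real.pi / 2 := by rw [abs_of_pos hpi]; linarith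
  have h1 : tricomiComb a w = k * kummerM a w := by
    rw [← hk w, tricomiComb]; ring_nf
  have h2 : (Gamma (1 - a))⁻¹ * tricomi a 1 w
      - (Gamma a)⁻¹ * (exp (exp w) * tricomi (1 - a) 1 (w + Real.pi * I)) = l * kummerM a w := by
    rw [← hl w]; ring
  rw [h1, h2, ← mul_assoc, ← mul_assoc]
  congr 1
  -- In this degenerate case the limits carry no information, but the shifted terms drop out, so k =
  -- l, and a is an integer, so the two phases agree.
  by_cases hG : (Gamma a)⁻¹ = 0
  · obtain ⟨n, hn⟩ := (Gamma_eq_zero_iff a).1 (inv_eq_zero.1 hG)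
    obtain ⟨x, hx⟩ := exists_kummerM_ne_zero a
    have hkl : k = l := by
      refine mul_right_cancel₀ hx ?_
      rw [← hk x, ← hl x, hG]; ring
    have he : exp (Real.pi * I * a) = exp (-(Real.pi * I * a)) := by
      rw [exp_eq_exp_iff_exists_int]
      exact ⟨-n, by rw [hn]; push_cast; ring⟩
    rw [hkl, he]
  · have t1 := (tendsto_connection (by simpa using him) (by simp) hk).const_mul l
    have t2 := (tendsto_connection (by simpa using him) (by simp) hl).const_mul k
    have h3 := tendsto_nhds_unique t1 (t2.congr fun x => by ring)
    have e1 : exp (-((1 - a) * -(Real.pi * I))) = -exp (-(Real.pi * I * a)) := by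
      rw [← neg_one_mul (exp _), ← exp_pi_mul_I, ← exp_add]; ring_nf
    have e2 : exp (-((1 - a) * (Real.pi * I))) = -exp (Real.pi * I * a) := by
      rw [← neg_one_mul (exp _), ← exp_neg_pi_mul_I, ← exp_add]; ring_nf
    rw [e1, e2] at h3
    refine mul_left_cancel₀ hG ?_
    linear_combination -h3

/-- `exp_mul_tricomiComb` with its left side moved by one period; w + iπ is rewritten as (w + 2πi) -
iπ, the argument that occurs in `hyperMatrix` at w + 2πi. -/
theorem tricomi_relation (a w : ℂ) :
    exp (Real.pi * I * a) * ((Gamma (1 - a))⁻¹ * tricomi a 1 (w + 2 * Real.pi * I)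
        - (Gamma a)⁻¹ * (exp (exp w) * tricomi (1 - a) 1 (w + 2 * Real.pi * I - Real.pi * I)))
      = exp (-(Real.pi * I * a)) * ((Gamma (1 - a))⁻¹ * tricomi a 1 w
        - (Gamma a)⁻¹ * (exp (exp w) *
          tricomi (1 - a) 1 (w + 2 * Real.pi * I - Real.pi * I))) := by
  have h := exp_mul_tricomiComb a w
  rw [← tricomiComb_add_two_pi, tricomiComb, exp_add w, exp_two_pi_mul_I, mul_one] at h
  rw [h]
  ring_nf

theorem tricomi_periodic (a w : ℂ) :
    (Gamma (1 - a))⁻¹ * tricomi a 1 (w + 2 * Real.pi * I)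
        - (Gamma a)⁻¹ * (exp (exp w) * tricomi (1 - a) 1 (w + 2 * Real.pi * I - Real.pi * I))
      = (Gamma (1 - a))⁻¹ * tricomi a 1 w
        - (Gamma a)⁻¹ * (exp (exp w) * tricomi (1 - a) 1 (w - Real.pi * I)) := by
  have h := tricomiComb_add_two_pi a w
  rwa [tricomiComb, tricomiComb, exp_add w, exp_two_pi_mul_I, mul_one] at h

/-- The monodromy of the matrix of confluent hypergeometric functions. -/
theorem hyperMatrix_monodromy {β : ℂ} (hβ : ∀ n : ℤ, n ≠ 0 → β ≠ (n : ℂ)) (w : ℂ) :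
    hyperMatrix β (w + 2 * Real.pi * I)
        * !![1, -exp (Real.pi * I * β);
            exp (Real.pi * I * β), 1 - exp (Real.pi * I * β) ^ 2]
      = hyperMatrix β w
        * !![1, -exp (-(Real.pi * I * β)); exp (Real.pi * I * β), 0] := by
  -- Excluding the nonzero integers is what makes Γ(1 - β) and Γ(1 + β) cancellable.
  have hG1 : Gamma (1 - β) ≠ 0 := Gamma_ne_zero fun m h => by
    refine hβ (m + 1) (by positivity) ?_
    push_cast
    linear_combination -h
  have hG2 : Gamma (1 + β) ≠ 0 := Gamma_ne_zero fun m h => by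
    refine hβ (-(m + 1)) (neg_ne_zero.2 (by positivity)) ?_
    push_cast
    linear_combination h
  have p1 := tricomi_periodic β w
  have r1 := tricomi_relation β w
  have p2 := tricomi_periodic (1 + β) w
  have r2 := tricomi_relation (1 + β) w
  have hsub : 1 - (1 + β) = -β := by ring
  have ea : exp (Real.pi * I * (1 + β)) = -exp (Real.pi * I * β) := by
    rw [← neg_one_mul (exp _), ← exp_pi_mul_I, ← exp_add]; ring_nf
  have eb : exp (-(Real.pi * I * (1 + β))) = -exp (-(Real.pi * I * β)) := by
    rw [← neg_one_mul (exp _), ← exp_neg_pi_mul_I, ← exp_add]; ring_nf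
  rw [hsub] at p2 r2
  rw [ea, eb] at r2
  have e2 : exp (2 * Real.pi * I * β) = exp (Real.pi * I * β) ^ 2 := by
    rw [← exp_nat_mul]; ring_nf
  have ehalf : exp (exp w / 2) = exp (exp w) * exp (-exp w / 2) := by rw [← exp_add]; ring_nf
  have einv : exp (Real.pi * I * β) * exp (-(Real.pi * I * β)) = 1 := by
    rw [← exp_add, add_neg_cancel, exp_zero]
  have i1 : Gamma (1 - β) * (Gamma (1 - β))⁻¹ = 1 := mul_inv_cancel₀ hG1
  have i2 : Gamma (1 + β) * (Gamma (1 + β))⁻¹ = 1 := mul_inv_cancel₀ hG2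
  simp only [hyperMatrix, exp_add w (2 * Real.pi * I), exp_two_pi_mul_I, mul_one, e2, ehalf,
    Matrix.mul_fin_two, mul_zero, add_zero, div_eq_mul_inv (Gamma _)]
  set e := exp (Real.pi * I * β)
  set e' := exp (-(Real.pi * I * β))
  set x := exp (-exp w / 2)
  -- The first row is the case a = β, the second a = 1 + β; the first column is periodicity, the
  -- second the phase relation.
  refine matrix_fin_two_congr ?_ ?_ ?_ ?_
  · linear_combination (e ^ 2 * x * Gamma (1 - β)) * p1
      - e ^ 2 * x * (tricomi β 1 (w + 2 * Real.pi * I) - tricomi β 1 w) * i1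
  · linear_combination (-e ^ 2 * x * Gamma (1 - β)) * r1
      + (e ^ 3 * x * tricomi β 1 (w + 2 * Real.pi * I) - e' * e ^ 2 * x * tricomi β 1 w) * i1
      + (e * x * Gamma (1 - β) * (Gamma β)⁻¹ * exp (exp w)
        * tricomi (1 - β) 1 (w + 2 * Real.pi * I - Real.pi * I)) * einv
  · linear_combination (-e * x * Gamma (1 + β)) * p2
      - e * x * exp (exp w) * (tricomi (-β) 1 (w + 2 * Real.pi * I - Real.pi * I)
        - tricomi (-β) 1 (w - Real.pi * I)) * i2
  · linear_combination (-e * x * Gamma (1 + β)) * r2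
      + exp (exp w) * x * tricomi (-β) 1 (w + 2 * Real.pi * I - Real.pi * I) * (e ^ 2 - 1) * i2
      - exp (exp w) * x * tricomi (-β) 1 (w + 2 * Real.pi * I - Real.pi * I)
        * Gamma (1 + β) * (Gamma (1 + β))⁻¹ * einv

/-! ### The lift to the covering and the argument in [0, 2π) -/

theorem argPos_exp {w : ℂ} (h0 : 0 ≤ w.im) (h1 : w.im < 2 * Real.pi) :
    argPos (exp w) = w.im := by
  have hpi := Real.pi_pos
  rcases le_or_gt w.im Real.pi with h | h
  · have harg : (exp w).arg = w.im := by
      rw [← log_im, log_exp (by linarith) h]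
    rw [argPos, harg, if_pos h0]
  · have harg : (exp w).arg = w.im - 2 * Real.pi := by
      have he : exp w = exp (w - 2 * Real.pi * I) := by
        rw [exp_sub, exp_two_pi_mul_I, div_one]
      have him : (w - 2 * Real.pi * I).im = w.im - 2 * Real.pi := by simp
      rw [he, ← log_im, log_exp (by rw [him]; linarith) (by rw [him]; linarith), him]
    rw [argPos, harg, if_neg (by linarith), sub_add_cancel]

theorem coverLift_exp {w : ℂ} (h0 : 0 ≤ w.im) (h1 : w.im < 2 * Real.pi) :
    coverLift (exp w) = w := by
  rw [coverLift, argPos_exp h0 h1, norm_exp, Real.log_exp, re_add_im]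

theorem argPos_zero : argPos 0 = 0 := by simp [argPos]

theorem argPos_nonneg (ζ : ℂ) : 0 ≤ argPos ζ := by
  have h := neg_pi_lt_arg ζ
  have hpi := Real.pi_pos
  rw [argPos]
  split_ifs <;> linarith

theorem norm_mul_exp_argPos (ζ : ℂ) : (‖ζ‖ : ℂ) * exp (argPos ζ * I) = ζ := by
  rw [argPos]
  split_ifs
  · exact norm_mul_exp_arg_mul_I ζ
  · have : ((ζ.arg + 2 * Real.pi : ℝ) : ℂ) * I = ζ.arg * I + 2 * Real.pi * I := by
      push_cast; ring
    rw [this, exp_add, exp_two_pi_mul_I, mul_one]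
    exact norm_mul_exp_arg_mul_I ζ

theorem im_mul_exp_neg (ζ : ℂ) (θ : ℝ) :
    (ζ * exp (-(θ * I))).im = ‖ζ‖ * Real.sin (argPos ζ - θ) := by
  conv_lhs => rw [← norm_mul_exp_argPos ζ]
  rw [mul_assoc, ← exp_add, im_ofReal_mul,
    show (argPos ζ : ℂ) * I + -(θ * I) = ((argPos ζ - θ : ℝ) : ℂ) * I by push_cast; ring,
    exp_ofReal_mul_I_im]

theorem im_eq_norm_mul_sin_argPos (ζ : ℂ) : ζ.im = ‖ζ‖ * Real.sin (argPos ζ) := by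
  simpa using im_mul_exp_neg ζ 0

theorem im_pos_of_argPos {ζ : ℂ} (h0 : 0 < argPos ζ) (h1 : argPos ζ < Real.pi) : 0 < ζ.im := by
  have hζ : ζ ≠ 0 := fun h => by simp [h, argPos_zero] at h0
  rw [im_eq_norm_mul_sin_argPos]
  exact mul_pos (norm_pos_iff.2 hζ) (Real.sin_pos_of_pos_of_lt_pi h0 h1)

theorem argPos_lt (ζ : ℂ) : argPos ζ < 2 * Real.pi := by
  have h := arg_le_pi ζ
  have hpi := Real.pi_pos
  rw [argPos]
  split_ifs <;> linarith

theorem im_neg_of_argPos {ζ : ℂ} (h0 : Real.pi < argPos ζ) : ζ.im < 0 := by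
  have hpi := Real.pi_pos
  have hζ : ζ ≠ 0 := fun h => by rw [h, argPos_zero] at h0; linarith
  rw [im_eq_norm_mul_sin_argPos, ← Real.sin_sub_two_pi]
  exact mul_neg_of_pos_of_neg (norm_pos_iff.2 hζ)
    (Real.sin_neg_of_neg_of_neg_pi_lt (by linarith [argPos_lt ζ]) (by linarith))

theorem mem_slitPlane_neg_of_argPos_pos {ζ : ℂ} (h : 0 < argPos ζ) : -ζ ∈ slitPlane := by
  have hζ : ζ ≠ 0 := fun h' => by simp [h', argPos_zero] at h
  rw [mem_slitPlane_iff]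
  by_contra! hcon
  obtain ⟨h1, h2⟩ := hcon
  rw [neg_re] at h1
  rw [neg_im, neg_eq_zero] at h2
  have : ζ.arg = 0 := arg_eq_zero_iff.2 ⟨by linarith, h2⟩
  rw [argPos, this] at h
  simp at h

/-- Turning by π moves the cut of the logarithm to the positive semi-axis, where `argPos` has its
jump; off it the lift is thus analytic. -/
theorem coverLift_eq_log_neg {ζ : ℂ} (h : -ζ ∈ slitPlane) :
    coverLift ζ = log (-ζ) + Real.pi * I ∧ argPos ζ = (log (-ζ) + Real.pi * I).im := by
  have hexp : exp (log (-ζ) + Real.pi * I) = ζ := by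
    rw [exp_add, exp_log (slitPlane_ne_zero h), exp_pi_mul_I]; ring
  have him : (log (-ζ) + Real.pi * I).im = (-ζ).arg + Real.pi := by
    rw [add_im, log_im]; simp
  have h1 := neg_pi_lt_arg (-ζ)
  have h2 : (-ζ).arg < Real.pi := lt_of_le_of_ne (arg_le_pi _) (mem_slitPlane_iff_arg.1 h).1
  have h3 := coverLift_exp (w := log (-ζ) + Real.pi * I) (by rw [him]; linarith)
    (by rw [him]; linarith)
  have h4 := argPos_exp (w := log (-ζ) + Real.pi * I) (by rw [him]; linarith)
    (by rw [him]; linarith)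
  rw [hexp] at h3 h4
  exact ⟨h3, h4⟩

theorem eventually_neg_mem_slitPlane {ζ₀ : ℂ} (h : 0 < argPos ζ₀) :
    ∀ᶠ ζ in 𝓝 ζ₀, -ζ ∈ slitPlane :=
  (continuous_neg.tendsto ζ₀).eventually
    (isOpen_slitPlane.mem_nhds (mem_slitPlane_neg_of_argPos_pos h))

theorem continuousAt_log_neg {ζ₀ : ℂ} (h : 0 < argPos ζ₀) :
    ContinuousAt (fun ζ => log (-ζ) + Real.pi * I) ζ₀ :=
  (continuousAt_neg.clog (mem_slitPlane_neg_of_argPos_pos h)).add continuousAt_const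

theorem continuousAt_coverLift {ζ₀ : ℂ} (h : 0 < argPos ζ₀) : ContinuousAt coverLift ζ₀ :=
  (continuousAt_log_neg h).congr (by
    filter_upwards [eventually_neg_mem_slitPlane h] with ζ hζ
    exact (coverLift_eq_log_neg hζ).1.symm)

theorem continuousAt_argPos {ζ₀ : ℂ} (h : 0 < argPos ζ₀) : ContinuousAt argPos ζ₀ :=
  (continuous_im.continuousAt.comp (continuousAt_log_neg h)).congr (by
    filter_upwards [eventually_neg_mem_slitPlane h] with ζ hζ
    exact (coverLift_eq_log_neg hζ).2.symm)

theorem ofReal_mul_exp_eq {r : ℝ} (hr : 0 < r) (θ : ℝ) :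
    (r : ℂ) * exp (θ * I) = exp ((Real.log r : ℂ) + θ * I) := by
  rw [exp_add, ← ofReal_exp, Real.exp_log hr]

theorem argPos_ofReal_mul_exp {r θ : ℝ} (hr : 0 < r) (h0 : 0 ≤ θ) (h1 : θ < 2 * Real.pi) :
    argPos (r * exp (θ * I)) = θ := by
  have him : ((Real.log r : ℂ) + θ * I).im = θ := by simp
  rw [ofReal_mul_exp_eq hr, argPos_exp (by rwa [him]) (by rwa [him]), him]

theorem eventually_argPos_near {r θ : ℝ} (hr : 0 < r) (h0 : 0 < θ) (h1 : θ < 2 * Real.pi)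
    {a b : ℝ} (ha : a < θ) (hb : θ < b) :
    ∀ᶠ ζ in 𝓝 ((r : ℂ) * exp (θ * I)),
      a < argPos ζ ∧ argPos ζ < b ∧ -Real.pi < argPos ζ - θ ∧ argPos ζ - θ < Real.pi := by
  have hpi := Real.pi_pos
  have hval := argPos_ofReal_mul_exp hr h0.le h1
  have hc := (continuousAt_argPos (ζ₀ := r * exp (θ * I)) (by rwa [hval])).tendsto
  rw [hval] at hc
  filter_upwards [hc.eventually (lt_mem_nhds ha), hc.eventually (gt_mem_nhds hb),
    hc.eventually (lt_mem_nhds (show θ - Real.pi < θ by linarith)),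
    hc.eventually (gt_mem_nhds (show θ < θ + Real.pi by linarith))] with ζ h1 h2 h3 h4
  exact ⟨h1, h2, by linarith, by linarith⟩

/-- Near the ray |argPos ζ - θ| < π, so the side of the line is decided by the sign of argPos ζ - θ
through its sine. -/
theorem eventually_argPos_left {r θ : ℝ} (hr : 0 < r) (h0 : 0 < θ) (h1 : θ < 2 * Real.pi)
    {b : ℝ} (hb : θ < b) :
    ∀ᶠ ζ in 𝓝[leftSide θ] ((r : ℂ) * exp (θ * I)), θ < argPos ζ ∧ argPos ζ < b := by
  filter_upwards [mem_nhdsWithin_of_mem_nhds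
    (eventually_argPos_near hr h0 h1 (show 0 < θ by assumption) hb), self_mem_nhdsWithin]
    with ζ h hside
  obtain ⟨-, h2, h3, -⟩ := h
  have hside : 0 < (ζ * exp (-(θ * I))).im := hside
  refine ⟨?_, h2⟩
  by_contra! hle
  rw [im_mul_exp_neg] at hside
  have := Real.sin_nonpos_of_nonpos_of_neg_pi_le (by linarith : argPos ζ - θ ≤ 0) h3.le
  exact absurd hside (not_lt.2 (mul_nonpos_of_nonneg_of_nonpos (norm_nonneg ζ) this))

theorem eventually_argPos_right {r θ : ℝ} (hr : 0 < r) (h0 : 0 < θ) (h1 : θ < 2 * Real.pi)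
    {a : ℝ} (ha : a < θ) :
    ∀ᶠ ζ in 𝓝[rightSide θ] ((r : ℂ) * exp (θ * I)), a < argPos ζ ∧ argPos ζ < θ := by
  filter_upwards [mem_nhdsWithin_of_mem_nhds
    (eventually_argPos_near hr h0 h1 ha (show θ < θ + 1 by linarith)), self_mem_nhdsWithin]
    with ζ h hside
  obtain ⟨h2, -, -, h3⟩ := h
  have hside : (ζ * exp (-(θ * I))).im < 0 := hside
  refine ⟨h2, ?_⟩
  by_contra! hle
  rw [im_mul_exp_neg] at hside
  have := Real.sin_nonneg_of_nonneg_of_le_pi (by linarith : 0 ≤ argPos ζ - θ) h3.le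
  exact absurd hside (not_lt.2 (mul_nonneg (norm_nonneg ζ) this))

/-! ### Analyticity and jumps of sectorwise products -/

theorem differentiable_tricomi (a : ℂ) : Differentiable ℂ (tricomi a 1) :=
  (isTricomi_tricomi a).differentiable

theorem differentiable_hyperMatrix_apply (β : ℂ) (i j : Fin 2) :
    Differentiable ℂ fun w => hyperMatrix β w i j := by
  have h1 := differentiable_tricomi β
  have h2 := (differentiable_tricomi (1 - β)).comp (differentiable_id.sub_const (Real.pi * I : ℂ))
  have h3 := differentiable_tricomi (1 + β)
  have h4 := (differentiable_tricomi (-β)).comp (differentiable_id.sub_const (Real.pi * I : ℂ))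
  simp only [Function.comp_def, id] at h2 h4
  fin_cases i <;> fin_cases j <;> simp only [hyperMatrix, Fin.zero_eta, Fin.mk_one, of_apply,
    cons_val', cons_val_zero, cons_val_one, cons_val_fin_one] <;> fun_prop

theorem differentiable_hyperMatrix_mul_apply (β : ℂ) (A : Matrix (Fin 2) (Fin 2) ℂ)
    (i j : Fin 2) : Differentiable ℂ fun w => (hyperMatrix β w * A) i j := by
  have h := differentiable_hyperMatrix_apply β
  simp only [Matrix.mul_apply, Fin.sum_univ_two]
  exact ((h i 0).mul_const _).add ((h i 1).mul_const _)

theorem continuous_hyperMatrix_mul (β : ℂ) (A : Matrix (Fin 2) (Fin 2) ℂ) :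
    Continuous fun w => hyperMatrix β w * A :=
  continuous_matrix fun i j => (differentiable_hyperMatrix_mul_apply β A i j).continuous

theorem tendsto_sector {β : ℂ} {N : ℝ → Matrix (Fin 2) (Fin 2) ℂ} {A : Matrix (Fin 2) (Fin 2) ℂ}
    {r θ : ℝ} (hr : 0 < r) (h0 : 0 < θ) (h1 : θ < 2 * Real.pi) {s : Set ℂ}
    (hN : ∀ᶠ ζ in 𝓝[s] ((r : ℂ) * exp (θ * I)), N (argPos ζ) = A) :
    Tendsto (fun ζ => hyperMatrix β (coverLift ζ) * N (argPos ζ)) (𝓝[s] ((r : ℂ) * exp (θ * I)))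
      (𝓝 (hyperMatrix β (coverLift (r * exp (θ * I))) * A)) := by
  have hval := argPos_ofReal_mul_exp hr h0.le h1
  have hc := (continuousAt_coverLift (ζ₀ := r * exp (θ * I)) (by rwa [hval])).tendsto
  refine ((((continuous_hyperMatrix_mul β A).tendsto _).comp hc).mono_left
    nhdsWithin_le_nhds).congr' ?_
  filter_upwards [hN] with ζ hζ
  rw [Function.comp, hζ]

/-- The lifted `hyperMatrix` is continuous across the ray, so the whole jump is that of the right
multiplier. -/
theorem jumpOutward_of_sectorwise {β : ℂ} {N : ℝ → Matrix (Fin 2) (Fin 2) ℂ}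
    {A B J : Matrix (Fin 2) (Fin 2) ℂ} {a θ b : ℝ} (h0 : 0 < θ) (h1 : θ < 2 * Real.pi)
    (ha : a < θ) (hb : θ < b) (hA : ∀ t, a < t → t < θ → N t = A)
    (hB : ∀ t, θ < t → t < b → N t = B) (hJ : B = A * J) :
    JumpOutward (fun ζ => hyperMatrix β (coverLift ζ) * N (argPos ζ)) θ J := by
  intro r hr
  refine ⟨_, _, tendsto_sector hr h0 h1 ((eventually_argPos_left hr h0 h1 hb).mono
    fun ζ h => hB _ h.1 h.2), tendsto_sector hr h0 h1 ((eventually_argPos_right hr h0 h1 ha).mono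
    fun ζ h => hA _ h.1 h.2), ?_⟩
  rw [hJ, Matrix.mul_assoc]

theorem jumpInward_of_sectorwise {β : ℂ} {N : ℝ → Matrix (Fin 2) (Fin 2) ℂ}
    {A B J : Matrix (Fin 2) (Fin 2) ℂ} {a θ b : ℝ} (h0 : 0 < θ) (h1 : θ < 2 * Real.pi)
    (ha : a < θ) (hb : θ < b) (hA : ∀ t, a < t → t < θ → N t = A)
    (hB : ∀ t, θ < t → t < b → N t = B) (hJ : A = B * J) :
    JumpInward (fun ζ => hyperMatrix β (coverLift ζ) * N (argPos ζ)) θ J := by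
  intro r hr
  refine ⟨_, _, tendsto_sector hr h0 h1 ((eventually_argPos_right hr h0 h1 ha).mono
    fun ζ h => hA _ h.1 h.2), tendsto_sector hr h0 h1 ((eventually_argPos_left hr h0 h1 hb).mono
    fun ζ h => hB _ h.1 h.2), ?_⟩
  rw [hJ, Matrix.mul_assoc]

theorem analyticAt_sectorwise {β : ℂ} {N : ℝ → Matrix (Fin 2) (Fin 2) ℂ} {ζ₀ : ℂ}
    (h0 : 0 < argPos ζ₀) (hN : ∀ᶠ t in 𝓝 (argPos ζ₀), N t = N (argPos ζ₀)) (i j : Fin 2) :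
    AnalyticAt ℂ (fun ζ => (hyperMatrix β (coverLift ζ) * N (argPos ζ)) i j) ζ₀ := by
  have hlog : AnalyticAt ℂ (fun ζ : ℂ => log (-ζ) + Real.pi * I) ζ₀ :=
    (analyticAt_id.neg.clog (mem_slitPlane_neg_of_argPos_pos h0)).add analyticAt_const
  have h := ((differentiable_hyperMatrix_mul_apply β (N (argPos ζ₀)) i j).analyticAt _).comp hlog
  refine h.congr ?_
  filter_upwards [eventually_neg_mem_slitPlane h0, (continuousAt_argPos h0).eventually hN]
    with ζ h1 h2
  rw [h2, (coverLift_eq_log_neg h1).1]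
  rfl

/-- Across the positive semi-axis, where `argPos` jumps from `2π` to `0`. -/
theorem analyticAt_sectorwise_of_pos {β : ℂ} {N : ℝ → Matrix (Fin 2) (Fin 2) ℂ}
    {A B : Matrix (Fin 2) (Fin 2) ℂ} {ζ₀ : ℂ} (hζ₀ : ζ₀ ≠ 0) (h0 : argPos ζ₀ = 0) {ε : ℝ}
    (hε : 0 < ε) (hA : ∀ t, t < ε → N t = A) (hB : ∀ t, 2 * Real.pi - ε < t → N t = B)
    (hAB : ∀ w, hyperMatrix β (w + 2 * Real.pi * I) * B = hyperMatrix β w * A) (i j : Fin 2) :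
    AnalyticAt ℂ (fun ζ => (hyperMatrix β (coverLift ζ) * N (argPos ζ)) i j) ζ₀ := by
  have harg : ζ₀.arg = 0 := by
    by_contra hne
    have hpi := neg_pi_lt_arg ζ₀
    have hpi' := Real.pi_pos
    rw [argPos] at h0
    split_ifs at h0
    · exact hne h0
    · linarith
  have hslit : ζ₀ ∈ slitPlane := mem_slitPlane_iff_arg.2 ⟨by rw [harg]; exact Real.pi_pos.ne, hζ₀⟩
  have h := ((differentiable_hyperMatrix_mul_apply β A i j).analyticAt _).comp
    (analyticAt_clog hslit)
  refine h.congr ?_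
  have hc := (continuousAt_arg hslit).tendsto
  rw [harg] at hc
  filter_upwards [hc.eventually (lt_mem_nhds (show -ε < 0 by linarith)),
    hc.eventually (gt_mem_nhds hε)] with ζ h1 h2
  -- The lift is log ζ on and above the axis and log ζ + 2πi below; `hAB` brings both to one
  -- analytic function of log ζ.
  by_cases hs : 0 ≤ ζ.arg
  · have e1 : argPos ζ = ζ.arg := by rw [argPos, if_pos hs]
    rw [hA _ (by rwa [e1]), coverLift, e1]
    rfl
  · have e1 : argPos ζ = ζ.arg + 2 * Real.pi := by rw [argPos, if_neg hs]
    have e2 : coverLift ζ = log ζ + 2 * Real.pi * I := by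
      rw [coverLift, e1, log]; push_cast; ring
    rw [hB _ (by rw [e1]; linarith), e2, hAB]
    rfl

theorem mem_contourRay_of_argPos_eq {ζ : ℂ} {θ : ℝ} (h : argPos ζ = θ) : ζ ∈ contourRay θ :=
  ⟨‖ζ‖, norm_nonneg ζ, by rw [← h, norm_mul_exp_argPos]⟩

/-! ### Solution of the Riemann-Hilbert problem -/

/-- The right multipliers which turn the matrix of confluent hypergeometric functions into the
solution of the model problem, as a function of `arg ζ`. -/
noncomputable def sectorMatrix (β : ℂ) (θ₂ θ₃ θ₅ θ₆ θ : ℝ) : Matrix (Fin 2) (Fin 2) ℂ :=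
  if θ < θ₆ then !![1, -exp (-(I * Real.pi * β)); exp (I * Real.pi * β), 0]
  else if θ < Real.pi / 2 then !![0, -exp (-(I * Real.pi * β)); exp (I * Real.pi * β), 0]
  else if θ < θ₂ then 1
  -- One matrix serves both halves of sector II: for Im ζ < 0 the entry is 2i sin πβ + e^(-iπβ) =
  -- e^(iπβ).
  else if θ < θ₃ then !![1, 0; exp (I * Real.pi * β), 1]
  else if θ < 3 * Real.pi / 2 then !![1, 0; 2 * I * Complex.sin (Real.pi * β), 1]
  else if θ < θ₅ then !![1, 0; 2 * I * Complex.sin (Real.pi * β), 1]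
    * !![0, -exp (I * Real.pi * β); exp (-(I * Real.pi * β)), 0]
  -- The triangular factor of Ψ in the lower half-plane times the matrix of sector V with ε = -1.
  else !![1, -exp (I * Real.pi * β); exp (I * Real.pi * β), 1 - exp (I * Real.pi * β) ^ 2]

theorem two_I_mul_sin (β : ℂ) : 2 * I * Complex.sin (Real.pi * β)
    = exp (I * Real.pi * β) - exp (-(I * Real.pi * β)) := by
  rw [Complex.sin, show -(Real.pi * β) * I = -(I * Real.pi * β) by ring,
    show Real.pi * β * I = I * Real.pi * β by ring]
  linear_combination
    (exp (-(I * Real.pi * β)) - exp (I * Real.pi * β)) * I_mul_I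

theorem exp_mul_exp_neg (x : ℂ) : exp x * exp (-x) = 1 := by
  rw [← exp_add, add_neg_cancel, exp_zero]

theorem proposition2 (β : ℂ) (hβ : ∀ n : ℤ, n ≠ 0 → β ≠ (n : ℂ))
    (θ₂ θ₃ θ₅ θ₆ : ℝ)
    (hθ₂ : Real.pi / 2 < θ₂ ∧ θ₂ < Real.pi)
    (hθ₃ : Real.pi < θ₃ ∧ θ₃ < 3 * Real.pi / 2)
    (hθ₅ : 3 * Real.pi / 2 < θ₅ ∧ θ₅ < 2 * Real.pi)
    (hθ₆ : 0 < θ₆ ∧ θ₆ < Real.pi / 2) :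
    (∀ a : ℂ, a ∈ ({β, -β, 1 - β, 1 + β} : Set ℂ) → ∃! F : ℂ → ℂ, IsTricomi a 1 F) ∧
    ∃ Y : ℂ → Matrix (Fin 2) (Fin 2) ℂ,
      HasModelFormulas β θ₂ θ₃ θ₅ θ₆ Y ∧ IsModelRHPSolution β θ₂ θ₃ θ₅ θ₆ Y := by
  have hpi := Real.pi_pos
  obtain ⟨h2a, h2b⟩ := hθ₂
  obtain ⟨h3a, h3b⟩ := hθ₃
  obtain ⟨h5a, h5b⟩ := hθ₅
  obtain ⟨h6a, h6b⟩ := hθ₆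
  have hinv := exp_mul_exp_neg (I * Real.pi * β)
  have hsin := two_I_mul_sin β
  have hmono : ∀ w, hyperMatrix β (w + 2 * Real.pi * I)
      * !![1, -exp (I * Real.pi * β); exp (I * Real.pi * β), 1 - exp (I * Real.pi * β) ^ 2]
      = hyperMatrix β w * !![1, -exp (-(I * Real.pi * β)); exp (I * Real.pi * β), 0] := by
    intro w
    have := hyperMatrix_monodromy hβ w
    rwa [mul_comm (Real.pi : ℂ) I] at this
  set N := sectorMatrix β θ₂ θ₃ θ₅ θ₆ with hN
  have nV : ∀ t, t < θ₆ → N t = !![1, -exp (-(I * Real.pi * β)); exp (I * Real.pi * β), 0] :=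
    fun t h => by rw [hN, sectorMatrix, if_pos h]
  have nVI : ∀ t, θ₆ < t → t < Real.pi / 2 →
      N t = !![0, -exp (-(I * Real.pi * β)); exp (I * Real.pi * β), 0] := fun t h h' => by
    rw [hN, sectorMatrix, if_neg (by linarith), if_pos h']
  have nI : ∀ t, Real.pi / 2 < t → t < θ₂ → N t = 1 := fun t h h' => by
    rw [hN, sectorMatrix, if_neg (by linarith), if_neg (by linarith), if_pos h']
  have nII : ∀ t, θ₂ < t → t < θ₃ → N t = !![1, 0; exp (I * Real.pi * β), 1] := fun t h h' => by
    rw [hN, sectorMatrix, if_neg (by linarith), if_neg (by linarith), if_neg (by linarith),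
      if_pos h']
  have nIII : ∀ t, θ₃ < t → t < 3 * Real.pi / 2 →
      N t = !![1, 0; 2 * I * Complex.sin (Real.pi * β), 1] := fun t h h' => by
    rw [hN, sectorMatrix, if_neg (by linarith), if_neg (by linarith), if_neg (by linarith),
      if_neg (by linarith), if_pos h']
  have nIV : ∀ t, 3 * Real.pi / 2 < t → t < θ₅ →
      N t = !![1, 0; 2 * I * Complex.sin (Real.pi * β), 1]
        * !![0, -exp (I * Real.pi * β); exp (-(I * Real.pi * β)), 0] := fun t h h' => by
    rw [hN, sectorMatrix, if_neg (by linarith), if_neg (by linarith), if_neg (by linarith),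
      if_neg (by linarith), if_neg (by linarith), if_pos h']
  have nV' : ∀ t, θ₅ < t → N t = !![1, -exp (I * Real.pi * β);
      exp (I * Real.pi * β), 1 - exp (I * Real.pi * β) ^ 2] := fun t h => by
    rw [hN, sectorMatrix, if_neg (by linarith), if_neg (by linarith), if_neg (by linarith),
      if_neg (by linarith), if_neg (by linarith), if_neg (by linarith)]
  refine ⟨fun a _ => existsUnique_isTricomi a,
    fun ζ => hyperMatrix β (coverLift ζ) * N (argPos ζ), ?_, ?_⟩
  · have hup : ∀ ζ : ℂ, 0 < ζ.im → modelPsi β ζ = hyperMatrix β (coverLift ζ) ∧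
        halfPlaneSign ζ = 1 := fun ζ h => ⟨by rw [modelPsi, if_pos h], by
          rw [halfPlaneSign, if_pos h]⟩
    have hdown : ∀ ζ : ℂ, ζ.im < 0 → modelPsi β ζ = hyperMatrix β (coverLift ζ)
        * !![1, 0; 2 * I * Complex.sin (Real.pi * β), 1] ∧ halfPlaneSign ζ = -1 :=
      fun ζ h => ⟨by rw [modelPsi, if_neg h.not_gt], by rw [halfPlaneSign, if_neg h.not_gt]⟩
    constructor
    · intro ζ h h'
      rw [nI _ h h', (hup ζ (im_pos_of_argPos (by linarith) (by linarith))).1, Matrix.mul_one]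
    · intro ζ him h h'
      rw [nII _ h h']
      rcases him.lt_or_gt with hs | hs
      · rw [(hdown ζ hs).1, (hdown ζ hs).2, Matrix.mul_assoc, hsin, mul_neg, mul_one,
          Matrix.mul_fin_two]
        congr 1
        refine matrix_fin_two_congr ?_ ?_ ?_ ?_ <;> ring
      · rw [(hup ζ hs).1, (hup ζ hs).2, mul_one]
    · intro ζ h h'
      rw [nIII _ h h', (hdown ζ (im_neg_of_argPos (by linarith))).1]
    · intro ζ h h'
      rw [nIV _ h h', (hdown ζ (im_neg_of_argPos (by linarith))).1, Matrix.mul_assoc]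
    · intro ζ him h
      rcases h with h | h
      · have hs := im_neg_of_argPos (show Real.pi < argPos ζ by linarith)
        rw [nV' _ h, (hdown ζ hs).1, (hdown ζ hs).2, Matrix.mul_assoc, hsin, mul_neg, mul_one,
          neg_neg, Matrix.mul_fin_two]
        congr 1
        refine matrix_fin_two_congr ?_ ?_ ?_ ?_
        · ring
        · ring
        · ring
        · linear_combination -hinv
      · have hs : 0 < ζ.im := by
          refine im_pos_of_argPos (lt_of_le_of_ne (argPos_nonneg ζ) fun h0 => him ?_)
            (by linarith)
          rw [im_eq_norm_mul_sin_argPos, ← h0, Real.sin_zero, mul_zero]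
        rw [nV _ h, (hup ζ hs).1, (hup ζ hs).2, mul_one]
    · intro ζ h h'
      rw [nVI _ h h', (hup ζ (im_pos_of_argPos (by linarith) (by linarith))).1]
  · constructor
    · intro i j ζ hζ
      have hray : ∀ θ, contourRay θ ⊆ contour θ₂ θ₃ θ₅ θ₆ → argPos ζ ≠ θ :=
        fun θ hsub h => hζ (hsub (mem_contourRay_of_argPos_eq h))
      -- The closed rays contain the origin.
      have hζ0 : ζ ≠ 0 := fun h => hζ (by
        rw [h]; simp only [contour, Set.mem_union]; right; exact ⟨0, le_rfl, by simp⟩)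
      rcases (argPos_nonneg ζ).eq_or_lt with h0 | h0
      · refine analyticAt_sectorwise_of_pos hζ0 h0.symm
          (ε := min θ₆ (2 * Real.pi - θ₅)) (lt_min h6a (by linarith))
          (fun t ht => nV t (ht.trans_le (min_le_left _ _)))
          (fun t ht => nV' t (by linarith [min_le_right θ₆ (2 * Real.pi - θ₅)])) hmono i j
      · refine analyticAt_sectorwise h0 ?_ i j
        -- Off the rays each comparison that defines the multiplier is locally constant, hence so is
        -- the multiplier.
        have hloc : ∀ θ, argPos ζ ≠ θ → ∀ᶠ t in 𝓝 (argPos ζ), (t < θ ↔ argPos ζ < θ) := by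
          intro θ hne
          rcases hne.lt_or_gt with h | h
          · filter_upwards [gt_mem_nhds h] with t ht using iff_of_true ht h
          · filter_upwards [lt_mem_nhds h] with t ht using iff_of_false ht.not_gt h.not_gt
        filter_upwards [hloc θ₆ (hray _ fun x hx => by simp [contour, hx]),
          hloc (Real.pi / 2) (hray _ fun x hx => by simp [contour, hx]),
          hloc θ₂ (hray _ fun x hx => by simp [contour, hx]),
          hloc θ₃ (hray _ fun x hx => by simp [contour, hx]),
          hloc (3 * Real.pi / 2) (hray _ fun x hx => by simp [contour, hx]),
          hloc θ₅ (hray _ fun x hx => by simp [contour, hx])] with t e1 e2 e3 e4 e5 e6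
        simp only [hN, sectorMatrix, e1, e2, e3, e4, e5, e6]
    · refine jumpOutward_of_sectorwise (by linarith) (by linarith) h6b h2a nVI nI ?_
      rw [Matrix.mul_fin_two, Matrix.one_fin_two]
      refine matrix_fin_two_congr ?_ ?_ ?_ ?_
      · linear_combination -hinv
      · ring
      · ring
      · linear_combination -hinv
    · refine jumpOutward_of_sectorwise (by linarith) (by linarith) h2a (by linarith) nI nII ?_
      rw [Matrix.one_mul]
    · refine jumpInward_of_sectorwise (by linarith) (by linarith) (by linarith) h3b nII nIII ?_
      rw [hsin, Matrix.mul_fin_two]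
      refine matrix_fin_two_congr ?_ ?_ ?_ ?_ <;> ring
    · refine jumpInward_of_sectorwise (by linarith) (by linarith) h3b h5a nIII nIV ?_
      rw [Matrix.mul_assoc, Matrix.mul_fin_two, Matrix.mul_fin_two]
      refine matrix_fin_two_congr ?_ ?_ ?_ ?_
      · linear_combination -hinv
      · ring
      · linear_combination (-2 * I * Complex.sin (Real.pi * β)) * hinv
      · linear_combination -hinv
    · refine jumpInward_of_sectorwise (by linarith) (by linarith) h5a h5b nIV
        (fun t h _ => nV' t h) ?_
      rw [hsin, Matrix.mul_fin_two, Matrix.mul_fin_two]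
      refine matrix_fin_two_congr ?_ ?_ ?_ ?_
      · linear_combination hinv
      · ring
      · linear_combination exp (I * Real.pi * β) * hinv
      · linear_combination hinv
    · refine jumpOutward_of_sectorwise h6a (by linarith) h6a h6b (fun t _ h => nV t h) nVI ?_
      rw [Matrix.mul_fin_two]
      refine matrix_fin_two_congr ?_ ?_ ?_ ?_
      · linear_combination hinv
      · ring
      · ring
      · ring
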